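/- **The calculus.** Fix sets of base types $b$, of constants $f : (A_1,\dots,A_n)\to B$ and of operations $\mathsf{op} : A_{\mathsf{op}} \rightsquigarrow B_{\mathsf{op}}\,!\,\tau_{\mathsf{op}}$, where $A_i, B, A_{\mathsf{op}}, B_{\mathsf{op}}$ are ground types $A ::= b \mid 1 \mid A\times A' \mid [\tau]A$ and time grades $\tau$ are natural numbers. Value types are $X ::= b \mid 1 \mid X\times Y \mid X \to Y\,!\,\tau \mid [\tau]X$. Contexts are $\Gamma ::= \cdot \mid \Gamma, x{:}X \mid \Gamma,\langle\tau\rangle$. The time $\mathsf{time}(\Gamma)$ is the sum of all $\tau$ with $\langle\tau\rangle$ in $\Gamma$, and $\Gamma \mathbin{\dot{-}} \tau$ is defined by $\Gamma\mathbin{\dot{-}} 0=\Gamma$, $\cdot\mathbin{\dot{-}}\tau_+=\cdot$, $(\Gamma,x{:}X)\mathbin{\dot{-}}\tau_+=\Gamma\mathbin{\dot{-}}\tau_+$, and $(\Gamma,\langle\tau'\rangle)\mathbin{\dot{-}}\tau_+=\Gamma,\langle\tau'-\tau_+\rangle$ if $\tau_+\le\tau'$ and $=\Gamma\mathbin{\dot{-}}(\tau_+-\tau')$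 otherwise, for $\tau_+>0$. Derivations $\Gamma\vdash J$, where $J$ is either $V:X$ (a value) or $M:X\,!\,\tau$ (a computation), are generated by the following rules. * Values: variables $x:X$ occurring anywhere in $\Gamma$; constants $f(V_1,\dots,V_n)$; $()$; pairs $(V,W)$; $\lambda x.M : X\to Y\,!\,\tau$ if $\Gamma,x{:}X\vdash M:Y\,!\,\tau$; $\mathsf{box}_\tau V:[\tau]X$ if $\Gamma,\langle\tau\rangle\vdash V:X$. * Computations: $\mathsf{return}\,V:X\,!\,0$; $\mathsf{let}\,x=M\,\mathsf{in}\,N:Y\,!\,\tau+\tau'$ if $\Gamma\vdash M:X\,!\,\tau$ and $\Gamma,\langle\tau\rangle,x{:}X\vdash N:Y\,!\,\tau'$; application $V\,W$; pattern matching $\mathsf{match}\,V\,\mathsf{with}\,(x,y)\mapsto N$; $\mathsf{op}\,V\,(x.M):X\,!\,\tau_{\mathsf{op}}+\tau$ if $\Gamma\vdash V:A_{\mathsf{op}}$ and $\Gamma,\langle\tau_{\mathsf{op}}\rangle,x{:}B_{\mathsf{op}}\vdash M:X\,!\,\tau$; $\mathsf{delay}\,\tau\,M:X\,!\,\tau+\tau'$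 if $\Gamma,\langle\tau\rangle\vdash M:X\,!\,\tau'$; $\mathsf{handle}\,M\,\mathsf{with}\,(x.k.M_{\mathsf{op}})_{\mathsf{op}}\,\mathsf{to}\,y\,\mathsf{in}\,N:Y\,!\,\tau+\tau'$ if $\Gamma\vdash M:X\,!\,\tau$, $\Gamma,\langle\tau\rangle,y{:}X\vdash N:Y\,!\,\tau'$ and $\Gamma,x{:}A_{\mathsf{op}},k{:}[\tau_{\mathsf{op}}](B_{\mathsf{op}}\to Y\,!\,\tau'')\vdash M_{\mathsf{op}}\,\tau'':Y\,!\,\tau_{\mathsf{op}}+\tau''$ for all $\mathsf{op}$ and all $\tau''$; $\mathsf{unbox}_\tau V\,\mathsf{as}\,x\,\mathsf{in}\,N:Y\,!\,\tau'$ if $\tau\le\mathsf{time}(\Gamma)$, $\Gamma\mathbin{\dot{-}}\tau\vdash V:[\tau]X$ and $\Gamma,x{:}X\vdash N:Y\,!\,\tau'$. **Renamings.** Renamings $\rho:\Gamma\rightsquigarrow\Gamma'$ are generated by identities; composition; weakening $\Gamma\rightsquigarrow\Gamma,x{:}X$; $\Gamma,y{:}X\rightsquigarrow\Gamma$ for each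 variable $x{:}X$ in $\Gamma$; $\Gamma,\langle0\rangle\rightsquigarrow\Gamma$ and $\Gamma\rightsquigarrow\Gamma,\langle0\rangle$; $\Gamma,\langle\tau+\tau'\rangle\rightsquigarrow\Gamma,\langle\tau\rangle,\langle\tau'\rangle$ and $\Gamma,\langle\tau\rangle,\langle\tau'\rangle\rightsquigarrow\Gamma,\langle\tau+\tau'\rangle$; $\Gamma,\langle\tau\rangle\rightsquigarrow\Gamma,\langle\tau'\rangle$ for $\tau\le\tau'$; and the congruences $\rho,x{:}X$ and $\rho,\langle\tau\rangle$. Each $\rho$ sends every variable $x{:}X$ of $\Gamma$ to a variable $\rho(x){:}X$ of $\Gamma'$, and induces a renaming $\rho\mathbin{\dot{-}}\tau:\Gamma\mathbin{\dot{-}}\tau\rightsquigarrow\Gamma'\mathbin{\dot{-}}\tau$, defined by recursion on $\rho$. The action $\Gamma'\vdash J[\rho]$ on derivations $\Gamma\vdash J$ replaces variables by their images, extending $\rho$ by the congruences when going under variable binders and $\langle\tau\rangle$, and acting by $\rho\mathbin{\dot{-}}\tau$ on the value $V$ of $\mathsf{unbox}_\tau V\,\mathsf{as}\,x\,\mathsf{in}\,N$.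 **Models.** Let $\mathbb C$ be a cartesian closed category with products indexed by the set of operations and by $\mathbb N$. Let $m:[\tau]A\times[\tau]B\to[\tau](A\times B)$ denote the canonical isomorphism of the right adjoint $[\tau]$ below. A model in $\mathbb C$ consists of the following. * Strong monoidal functors $[-]:(\mathbb N,\le)\to[\mathbb C,\mathbb C]$ and $\langle-\rangle:(\mathbb N,\le)^{\mathrm{op}}\to[\mathbb C,\mathbb C]$, with structure isomorphisms $\varepsilon:[0]A\cong A$, $\delta:[\tau_1+\tau_2]A\cong[\tau_1]([\tau_2]A)$, $\eta:A\cong\langle0\rangle A$, $\mu:\langle\tau_1\rangle(\langle\tau_2\rangle A)\cong\langle\tau_1+\tau_2\rangle A$. * Adjunctions $\langle\tau\rangle\dashv[\tau]$ with units $\eta^\dashv_\tau$ and counits $\varepsilon^\dashv_\tau$ satisfying, up to the identification $\tau_1+\tau_2=\tau_2+\tau_1$, the laws $[\tau](\langle0\le\tau\rangle)\circ\eta^\dashv_\tau\circ\eta^{-1}\circ\varepsilon=[0\le\tau]:[0](\langle0\rangle A)\to[\tau](\langle0\rangle A)$; $\langle0\rangle([0\le\tau])\circ\eta\circ\varepsilon^{-1}\circ\varepsilon^\dashv_\tau=\langle0\le\tau\rangle:\langle\tau\rangle([\tau]A)\to\langle0\rangle([\tau]A)$;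 $[\tau_1]([\tau_2]\mu)\circ[\tau_1]\eta^\dashv_{\tau_2}\circ\eta^\dashv_{\tau_1}=\delta\circ\eta^\dashv_{\tau_1+\tau_2}$; and $\varepsilon^\dashv_{\tau_1}\circ\langle\tau_1\rangle\varepsilon^\dashv_{\tau_2}\circ\langle\tau_1\rangle(\langle\tau_2\rangle\delta)=\varepsilon^\dashv_{\tau_1+\tau_2}\circ\mu$. * A $[-]$-strong graded monad: functors $T\,\tau$ with natural transformations $\eta^T:A\to T\,0\,A$ and $\mu^T:T\,\tau_1(T\,\tau_2\,A)\to T\,(\tau_1+\tau_2)\,A$ satisfying the graded monad laws, and natural $\mathsf{str}:[\tau]A\times T\,\tau\,B\to T\,\tau\,(A\times B)$ compatible with $\eta^T$ (through $\varepsilon^{-1}$), with $\mu^T$ (through $\delta^{-1}$), with the second projection, and with associativity of $\times$ (through $m$). * An object for each base type, which yields $[\![ X]\!]$ for all value types with $[\![ X\to Y\,!\,\tau]\!]=[\![ X]\!]\Rightarrow T\,\tau\,[\![ Y]\!]$ and $[\![[\tau]X]\!]=[\tau][\![ X]\!]$, and a morphism $[\![ A_1]\!]\times\dots\times[\![ A_n]\!]\to[\![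 B]\!]$ for each constant. * Natural transformations $\mathsf{op}:[\![ A_{\mathsf{op}}]\!]\times[\tau_{\mathsf{op}}]([\![ B_{\mathsf{op}}]\!]\Rightarrow T\,\tau\,A)\to T\,(\tau_{\mathsf{op}}+\tau)\,A$ and $\mathsf{delay}:[\tau](T\,\tau'\,A)\to T\,(\tau+\tau')\,A$ that are algebraic, that is, that commute with $\mu^T$ and with $\mathsf{str}$. * With $\mathcal H_A=\prod_{\mathsf{op}}\prod_{\tau}\big([\![ A_{\mathsf{op}}]\!]\times[\tau_{\mathsf{op}}]([\![ B_{\mathsf{op}}]\!]\Rightarrow T\,\tau\,A)\Rightarrow T\,(\tau_{\mathsf{op}}+\tau)\,A\big)$, handling morphisms $h:\mathcal H_A\to\big(T\,\tau(T\,\tau'\,A)\Rightarrow T\,(\tau+\tau')\,A\big)$ satisfying three equations: $h$ is the identity on $\eta^T$; it commutes with $\mathsf{delay}$; and on $\mathsf{op}$ it applies the corresponding clause, with $h$ applied recursively in the continuation. **Interpretation.** Contexts denote functors: $[\![\cdot]\!] A=A$, $[\![\Gamma,x{:}X]\!] A=[\![\Gamma]\!] A\times[\![ X]\!]$, $[\![\Gamma,\langle\tau\rangle]\!]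 A=\langle\tau\rangle([\![\Gamma]\!] A)$. Derivations denote morphisms $[\![\Gamma\vdash V:X]\!]:[\![\Gamma]\!]1\to[\![ X]\!]$ and $[\![\Gamma\vdash M:X\,!\,\tau]\!]:[\![\Gamma]\!]1\to T\,\tau\,[\![ X]\!]$, defined by recursion: * A variable $x$ in $\Gamma_1,x{:}X,\Gamma_2$ denotes, at each object $A$, the composite $[\![ x]\!]_A:[\![\Gamma_1,x{:}X,\Gamma_2]\!] A=[\![\Gamma_2]\!]([\![\Gamma_1]\!] A\times[\![ X]\!])\to\langle\mathsf{time}(\Gamma_2)\rangle([\![\Gamma_1]\!] A\times[\![ X]\!])\to\langle0\rangle([\![\Gamma_1]\!] A\times[\![ X]\!])\cong[\![\Gamma_1]\!] A\times[\![ X]\!]\to[\![ X]\!]$, and its denotation as a value is $[\![ x]\!]_1$. * Constants, products and functions use the morphisms of the constants and the cartesian closed structure; $[\![\mathsf{box}_\tau V]\!]=[\tau][\![ V]\!]\circ\eta^\dashv_\tau$; $[\![\mathsf{return}\,V]\!]=\eta^T\circ[\![ V]\!]$; $[\![\mathsf{let}\,x=M\,\mathsf{in}\,N]\!]=\mu^T\circ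 T\,\tau\,[\![ N]\!]\circ\mathsf{str}\circ\langle\eta^\dashv_\tau,[\![ M]\!]\rangle$; $[\![\mathsf{op}\,V\,(x.M)]\!]=\mathsf{op}\circ\langle[\![ V]\!],[\tau_{\mathsf{op}}](\mathsf{curry}[\![ M]\!])\circ\eta^\dashv_{\tau_{\mathsf{op}}}\rangle$; $[\![\mathsf{delay}\,\tau\,M]\!]=\mathsf{delay}\circ[\tau][\![ M]\!]\circ\eta^\dashv_\tau$. * $\mathsf{handle}$ denotes $\mathsf{uncurry}(h)\circ\langle[\![ H]\!],\,T\,\tau\,[\![ N]\!]\circ\mathsf{str}\circ\langle\eta^\dashv_\tau,[\![ M]\!]\rangle\rangle$, where $[\![ H]\!]:[\![\Gamma]\!]1\to\mathcal H_{[\![ Y]\!]}$ is the tuple of all curried clauses $[\![ M_{\mathsf{op}}\,\tau'']\!]$. * $[\![\mathsf{unbox}_\tau V\,\mathsf{as}\,x\,\mathsf{in}\,N]\!]=[\![ N]\!]\circ\langle\mathrm{id},\,\varepsilon^\dashv_\tau\circ\langle\tau\rangle[\![ V]\!]\circ\eta^{\mathrm{PRA}}\rangle$, where, for $\tau\le\mathsf{time}(\Gamma)$,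 $\eta^{\mathrm{PRA}}:[\![\Gamma]\!] A\to\langle\tau\rangle([\![\Gamma\mathbin{\dot{-}}\tau]\!] A)$ is defined by recursion on $\Gamma$ by merging $\tau$ worth of the rightmost modalities of $\Gamma$. For every object $A$ and every $\rho:\Gamma\rightsquigarrow\Gamma'$, the morphism $[\![\rho]\!]_A:[\![\Gamma']\!] A\to[\![\Gamma]\!] A$ is defined by induction on $\rho$. In the order of the generators above, it is the identity; $[\![\rho'\circ\rho]\!]_A=[\![\rho]\!]_A\circ[\![\rho']\!]_A$; the first projection; $\langle\mathrm{id},[\![ x]\!]_A\rangle$; $\eta$ and $\eta^{-1}$; $\mu$ and $\mu^{-1}$, up to $\tau+\tau'=\tau'+\tau$; $\langle\tau\le\tau'\rangle$; $[\![\rho]\!]_A\times\mathrm{id}$ and $\langle\tau\rangle([\![\rho]\!]_A)$. **Proposition.** In every such model, let $\rho:\Gamma\rightsquigarrow\Gamma'$ be a renaming. Then, for every derivation $\Gamma\vdash J$ of a value or of a computation, $$[\![ J[\rho]]\!]=[\![ J]\!]\circ[\![\rho]\!]_1 .$$ Moreover, $[\![\rho]\!]_A$ is natural in $A$: for every $f:A\to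 A'$ one has $[\![\rho]\!]_{A'}\circ[\![\Gamma']\!] f=[\![\Gamma]\!] f\circ[\![\rho]\!]_A$. -/

import Mathlib

open CategoryTheory Limits MonoidalCategory CartesianMonoidalCategory

universe w v u

attribute [-instance] CategoryTheory.catToReflQuiver

namespace LambdaTau

/-! ## Types, contexts and terms -/

/-- Ground types over a set `B` of base types; time grades are natural numbers. -/
inductive Ground (B : Type w) : Type w
  | base : B → Ground B
  | unit : Ground B
  | prod : Ground B → Ground B → Ground B
  | box : ℕ → Ground B → Ground B

/-- Value types; `fn X Y τ` is the type of functions from `X` to computations `Y ! τ`. -/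
inductive Ty (B : Type w) : Type w
  | base : B → Ty B
  | unit : Ty B
  | prod : Ty B → Ty B → Ty B
  | fn : Ty B → Ty B → ℕ → Ty B
  | box : ℕ → Ty B → Ty B

/-- Every ground type is a value type. -/
def Ground.toTy {B : Type w} : Ground B → Ty B
  | .base b => .base b
  | .unit => .unit
  | .prod A A' => .prod A.toTy A'.toTy
  | .box τ A => .box τ A.toTy

/-- A signature: base types, constants `f : (A₁, …, Aₙ) → B`, and operations
`op : A_op ⇝ B_op ! τ_op`, all typed with ground types. -/
structure Signature where
  Base : Type w
  Const : Type w
  arity : Const → ℕ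
  constDom : (f : Const) → Fin (arity f) → Ground Base
  constCod : Const → Ground Base
  Op : Type w
  param : Op → Ground Base
  result : Op → Ground Base
  time : Op → ℕ

/-- Temporal typing contexts, with nameless variables. -/
inductive Ctx (B : Type w) : Type w
  | nil : Ctx B
  | var : Ctx B → Ty B → Ctx B
  | mod : Ctx B → ℕ → Ctx B

namespace Ctx

variable {B : Type w}

/-- The time captured by a context. -/
@[reducible] def time : Ctx B → ℕ
  | nil => 0
  | var Γ _ => Γ.time
  | mod Γ τ => Γ.time + τ

/-- The "time travelling" operation on contexts. -/
@[reducible] def minus : Ctx B → ℕ → Ctx B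
  | Γ, 0 => Γ
  | nil, _ + 1 => nil
  | var Γ _, τ + 1 => minus Γ (τ + 1)
  | mod Γ τ', τ + 1 =>
      if τ + 1 ≤ τ' then mod Γ (τ' - (τ + 1)) else minus Γ (τ + 1 - τ')

theorem minus_zero (Γ : Ctx B) : Γ.minus 0 = Γ := by
  cases Γ <;> rfl

theorem minus_mod_of_le (Γ : Ctx B) {τ τ' : ℕ} (h : τ ≤ τ') :
    (Γ.mod τ').minus τ = Γ.mod (τ' - τ) := by
  cases τ with
  | zero => rfl
  | succ τ => simp [minus, h]

theorem minus_mod_of_ge (Γ : Ctx B) {τ τ' : ℕ} (h : τ' < τ) :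
    (Γ.mod τ').minus τ = Γ.minus (τ - τ') := by
  cases τ with
  | zero => omega
  | succ τ => simp [minus, Nat.not_le.mpr h]

end Ctx

/-- `Var Γ X` is the set of occurrences of variables of type `X` in `Γ`; context modalities to
the right of a variable do not restrict its use. -/
inductive Var {B : Type w} : Ctx B → Ty B → Type w
  | here {Γ : Ctx B} {X : Ty B} : Var (Γ.var X) X
  | skipVar {Γ : Ctx B} {X Y : Ty B} : Var Γ X → Var (Γ.var Y) X
  | skipMod {Γ : Ctx B} {X : Ty B} {τ : ℕ} : Var Γ X → Var (Γ.mod τ) X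

namespace Var

variable {B : Type w}

/-- The part `Γ₁` of a context `Γ₁, x : X, Γ₂` to the left of the variable `x`. -/
@[reducible] def left {Γ : Ctx B} {X : Ty B} : Var Γ X → Ctx B
  | here (Γ := Γ) => Γ
  | skipVar x => x.left
  | skipMod x => x.left

/-- The part `Γ₂` of a context `Γ₁, x : X, Γ₂` to the right of the variable `x`. -/
@[reducible] def right {Γ : Ctx B} {X : Ty B} : Var Γ X → Ctx B
  | here => .nil
  | skipVar (Y := Y) x => x.right.var Y
  | skipMod (τ := τ) x => x.right.mod τ

end Var

/-- What a typing judgement asserts: being a value of type `X`, or being a computation of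
type `X ! τ`. -/
inductive Judg (B : Type w) : Type w
  | val : Ty B → Judg B
  | comp : Ty B → ℕ → Judg B

/-- Typing derivations `Γ ⊢ J`, for values and for computations, that is, well-typed terms up to
renaming of bound variables. -/
inductive Tm (S : Signature.{w}) : Ctx S.Base → Judg S.Base → Type w
  | var {Γ X} : Var Γ X → Tm S Γ (.val X)
  | const {Γ} (f : S.Const) (V : (i : Fin (S.arity f)) → Tm S Γ (.val (S.constDom f i).toTy)) :
      Tm S Γ (.val (S.constCod f).toTy)
  | unit {Γ} : Tm S Γ (.val .unit)
  | pair {Γ X Y} (V : Tm S Γ (.val X)) (W : Tm S Γ (.val Y)) : Tm S Γ (.val (.prod X Y))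
  | lam {Γ X Y τ} (M : Tm S (Γ.var X) (.comp Y τ)) : Tm S Γ (.val (.fn X Y τ))
  | box {Γ X} (τ : ℕ) (V : Tm S (Γ.mod τ) (.val X)) : Tm S Γ (.val (.box τ X))
  | ret {Γ X} (V : Tm S Γ (.val X)) : Tm S Γ (.comp X 0)
  | letIn {Γ X Y τ τ'} (M : Tm S Γ (.comp X τ)) (N : Tm S ((Γ.mod τ).var X) (.comp Y τ')) :
      Tm S Γ (.comp Y (τ + τ'))
  | app {Γ X Y τ} (V : Tm S Γ (.val (.fn X Y τ))) (W : Tm S Γ (.val X)) : Tm S Γ (.comp Y τ)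
  | split {Γ X Y Z τ} (V : Tm S Γ (.val (.prod X Y)))
      (N : Tm S ((Γ.var X).var Y) (.comp Z τ)) : Tm S Γ (.comp Z τ)
  | perform {Γ X τ} (o : S.Op) (V : Tm S Γ (.val (S.param o).toTy))
      (M : Tm S ((Γ.mod (S.time o)).var (S.result o).toTy) (.comp X τ)) :
      Tm S Γ (.comp X (S.time o + τ))
  | delay {Γ X τ'} (τ : ℕ) (M : Tm S (Γ.mod τ) (.comp X τ')) : Tm S Γ (.comp X (τ + τ'))
  | handle {Γ X Y τ τ'} (M : Tm S Γ (.comp X τ))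
      (H : (o : S.Op) → (τ'' : ℕ) →
        Tm S ((Γ.var (S.param o).toTy).var (.box (S.time o) (.fn (S.result o).toTy Y τ'')))
          (.comp Y (S.time o + τ'')))
      (N : Tm S ((Γ.mod τ).var X) (.comp Y τ')) : Tm S Γ (.comp Y (τ + τ'))
  | unbox {Γ X Y τ'} (τ : ℕ) (h : τ ≤ Γ.time) (V : Tm S (Γ.minus τ) (.val (.box τ X)))
      (N : Tm S (Γ.var X) (.comp Y τ')) : Tm S Γ (.comp Y τ')

/-! ## Renamings -/

/-- The renaming relation `ρ : Γ ⇝ Γ'`. -/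
inductive Ren {B : Type w} : Ctx B → Ctx B → Type w
  | id {Γ : Ctx B} : Ren Γ Γ
  | comp {Γ Γ' Γ'' : Ctx B} : Ren Γ' Γ'' → Ren Γ Γ' → Ren Γ Γ''
  | wk {Γ : Ctx B} {X : Ty B} : Ren Γ (Γ.var X)
  | var {Γ : Ctx B} {X : Ty B} : Var Γ X → Ren (Γ.var X) Γ
  | eta {Γ : Ctx B} : Ren (Γ.mod 0) Γ
  | etaInv {Γ : Ctx B} : Ren Γ (Γ.mod 0)
  | mu {Γ : Ctx B} (τ τ' : ℕ) : Ren (Γ.mod (τ + τ')) ((Γ.mod τ).mod τ')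
  | muInv {Γ : Ctx B} (τ τ' : ℕ) : Ren ((Γ.mod τ).mod τ') (Γ.mod (τ + τ'))
  | mon {Γ : Ctx B} {τ τ' : ℕ} (h : τ ≤ τ') : Ren (Γ.mod τ) (Γ.mod τ')
  | congVar {Γ Γ' : Ctx B} {X : Ty B} : Ren Γ Γ' → Ren (Γ.var X) (Γ'.var X)
  | congMod {Γ Γ' : Ctx B} {τ : ℕ} : Ren Γ Γ' → Ren (Γ.mod τ) (Γ'.mod τ)

namespace Ren

variable {B : Type w}

/-- The variable `ρ x` that `ρ` maps `x` to. -/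
def onVar : {Γ Γ' : Ctx B} → Ren Γ Γ' → {X : Ty B} → Var Γ X → Var Γ' X
  | _, _, .id, _, x => x
  | _, _, .comp ρ' ρ, _, x => ρ'.onVar (ρ.onVar x)
  | _, _, .wk, _, x => .skipVar x
  | _, _, .var y, _, .here => y
  | _, _, .var _, _, .skipVar x => x
  | _, _, .eta, _, .skipMod x => x
  | _, _, .etaInv, _, x => .skipMod x
  | _, _, .mu _ _, _, .skipMod x => .skipMod (.skipMod x)
  | _, _, .muInv _ _, _, .skipMod (.skipMod x) => .skipMod x
  | _, _, .mon _, _, .skipMod x => .skipMod x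
  | _, _, .congVar _, _, .here => .here
  | _, _, .congVar ρ, _, .skipVar x => .skipVar (ρ.onVar x)
  | _, _, .congMod ρ, _, .skipMod x => .skipMod (ρ.onVar x)

theorem time_le {Γ Γ' : Ctx B} (ρ : Ren Γ Γ') : Γ.time ≤ Γ'.time := by
  induction ρ <;> try simp only [Ctx.time]
  all_goals omega

/-- Transport of a renaming along equalities of contexts. -/
def cast {Γ₁ Γ₂ Γ₁' Γ₂' : Ctx B} (h : Γ₁ = Γ₂) (h' : Γ₁' = Γ₂') (ρ : Ren Γ₁ Γ₁') :
    Ren Γ₂ Γ₂' :=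
  h ▸ h' ▸ ρ

/-- `Γ ⇝ Γ, ⟨τ⟩`. -/
def wkMod {Γ : Ctx B} (τ : ℕ) : Ren Γ (Γ.mod τ) :=
  .comp (.mon (Nat.zero_le τ)) .etaInv

/-- `Γ - τ ⇝ Γ`. -/
def minusWk : (Γ : Ctx B) → (τ : ℕ) → Ren (Γ.minus τ) Γ
  | Γ, 0 => cast Γ.minus_zero.symm rfl .id
  | .nil, _ + 1 => .id
  | .var Γ _, τ + 1 => .comp .wk (minusWk Γ (τ + 1))
  | .mod Γ τ', τ + 1 =>
      if h : τ + 1 ≤ τ' then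
        cast (Γ.minus_mod_of_le h).symm rfl (.mon (Nat.sub_le τ' (τ + 1)))
      else
        cast (Γ.minus_mod_of_ge (Nat.lt_of_not_le h)).symm rfl
          (.comp (wkMod τ') (minusWk Γ (τ + 1 - τ')))

/-- `Γ - τ₂ ⇝ Γ - τ₁` for `τ₁ ≤ τ₂`. -/
def minusMono : (Γ : Ctx B) → (τ₁ τ₂ : ℕ) → τ₁ ≤ τ₂ → Ren (Γ.minus τ₂) (Γ.minus τ₁)
  | Γ, 0, τ₂, _ => cast rfl Γ.minus_zero.symm (minusWk Γ τ₂)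
  | .nil, _ + 1, _ + 1, _ => .id
  | .var Γ _, τ₁ + 1, τ₂ + 1, h => minusMono Γ (τ₁ + 1) (τ₂ + 1) h
  | .mod Γ τ', τ₁ + 1, τ₂ + 1, h =>
      if h₂ : τ₂ + 1 ≤ τ' then
        cast (Γ.minus_mod_of_le h₂).symm (Γ.minus_mod_of_le (h.trans h₂)).symm
          (.mon (Nat.sub_le_sub_left h τ'))
      else if h₁ : τ₁ + 1 ≤ τ' then
        cast (Γ.minus_mod_of_ge (Nat.lt_of_not_le h₂)).symm (Γ.minus_mod_of_le h₁).symm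
          (.comp (wkMod (τ' - (τ₁ + 1))) (minusWk Γ (τ₂ + 1 - τ')))
      else
        cast (Γ.minus_mod_of_ge (Nat.lt_of_not_le h₂)).symm
          (Γ.minus_mod_of_ge (Nat.lt_of_not_le h₁)).symm
          (minusMono Γ (τ₁ + 1 - τ') (τ₂ + 1 - τ') (Nat.sub_le_sub_right h τ'))

/-- `(Γ, ⟨τ + τ'⟩) - σ ⇝ (Γ, ⟨τ⟩, ⟨τ'⟩) - σ`. -/
def minusMu (Γ : Ctx B) (τ τ' σ : ℕ) :
    Ren ((Γ.mod (τ + τ')).minus σ) (((Γ.mod τ).mod τ').minus σ) :=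
  if h₁ : σ ≤ τ' then
    cast (by rw [Ctx.minus_mod_of_le _ (by omega), Nat.add_sub_assoc h₁])
      ((Γ.mod τ).minus_mod_of_le h₁).symm (.mu (Γ := Γ) τ (τ' - σ))
  else
    cast rfl
      (by
        rw [Ctx.minus_mod_of_ge _ (Nat.lt_of_not_le h₁)]
        by_cases h₂ : σ ≤ τ + τ'
        · rw [Ctx.minus_mod_of_le _ h₂, Ctx.minus_mod_of_le _ (by omega)]
          congr 1
          omega
        · rw [Ctx.minus_mod_of_ge _ (by omega), Ctx.minus_mod_of_ge _ (by omega)]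
          congr 1
          omega)
      .id

/-- `(Γ, ⟨τ⟩, ⟨τ'⟩) - σ ⇝ (Γ, ⟨τ + τ'⟩) - σ`. -/
def minusMuInv (Γ : Ctx B) (τ τ' σ : ℕ) :
    Ren (((Γ.mod τ).mod τ').minus σ) ((Γ.mod (τ + τ')).minus σ) :=
  if h₁ : σ ≤ τ' then
    cast ((Γ.mod τ).minus_mod_of_le h₁).symm
      (by rw [Ctx.minus_mod_of_le _ (by omega), Nat.add_sub_assoc h₁])
      (.muInv (Γ := Γ) τ (τ' - σ))
  else
    cast rfl
      (by
        rw [Ctx.minus_mod_of_ge _ (Nat.lt_of_not_le h₁)]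
        by_cases h₂ : σ ≤ τ + τ'
        · rw [Ctx.minus_mod_of_le _ h₂, Ctx.minus_mod_of_le _ (by omega)]
          congr 1
          omega
        · rw [Ctx.minus_mod_of_ge _ (by omega), Ctx.minus_mod_of_ge _ (by omega)]
          congr 1
          omega)
      .id

/-- `(Γ, ⟨τ⟩) - σ ⇝ (Γ, ⟨τ'⟩) - σ` for `τ ≤ τ'`. -/
def minusMon (Γ : Ctx B) {τ τ' : ℕ} (h : τ ≤ τ') (σ : ℕ) :
    Ren ((Γ.mod τ).minus σ) ((Γ.mod τ').minus σ) :=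
  if h₁ : σ ≤ τ then
    cast (Γ.minus_mod_of_le h₁).symm (Γ.minus_mod_of_le (h₁.trans h)).symm
      (.mon (Nat.sub_le_sub_right h σ))
  else if h₂ : σ ≤ τ' then
    cast (Γ.minus_mod_of_ge (Nat.lt_of_not_le h₁)).symm (Γ.minus_mod_of_le h₂).symm
      (.comp (wkMod (τ' - σ)) (minusWk Γ (σ - τ)))
  else
    cast (Γ.minus_mod_of_ge (Nat.lt_of_not_le h₁)).symm
      (Γ.minus_mod_of_ge (Nat.lt_of_not_le h₂)).symm
      (minusMono Γ (σ - τ') (σ - τ) (Nat.sub_le_sub_left h σ))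

/-- The operation `ρ - σ : (Γ - σ) ⇝ (Γ' - σ)` on renamings `ρ : Γ ⇝ Γ'`. -/
def minus : {Γ Γ' : Ctx B} → Ren Γ Γ' → (σ : ℕ) → Ren (Γ.minus σ) (Γ'.minus σ)
  | _, _, .id, _ => .id
  | _, _, .comp ρ' ρ, σ => .comp (ρ'.minus σ) (ρ.minus σ)
  | _, _, .wk (Γ := Γ), 0 => cast Γ.minus_zero.symm rfl .wk
  | _, _, .wk, _ + 1 => .id
  | _, _, .var (Γ := Γ) x, 0 => cast rfl Γ.minus_zero.symm (.var x)
  | _, _, .var _, _ + 1 => .id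
  | _, _, .eta (Γ := Γ), 0 => cast rfl Γ.minus_zero.symm .eta
  | _, _, .eta (Γ := Γ), σ + 1 => cast (Γ.minus_mod_of_ge (Nat.succ_pos σ)).symm rfl .id
  | _, _, .etaInv (Γ := Γ), 0 => cast Γ.minus_zero.symm rfl .etaInv
  | _, _, .etaInv (Γ := Γ), σ + 1 => cast rfl (Γ.minus_mod_of_ge (Nat.succ_pos σ)).symm .id
  | _, _, .mu (Γ := Γ) τ τ', σ => minusMu Γ τ τ' σ
  | _, _, .muInv (Γ := Γ) τ τ', σ => minusMuInv Γ τ τ' σ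
  | _, _, .mon (Γ := Γ) h, σ => minusMon Γ h σ
  | _, _, .congVar ρ, 0 => .congVar ρ
  | _, _, .congVar ρ, σ + 1 => ρ.minus (σ + 1)
  | _, _, .congMod (Γ := Γ) (Γ' := Γ') (τ := τ) ρ, σ =>
      if h : σ ≤ τ then
        cast (Γ.minus_mod_of_le h).symm (Γ'.minus_mod_of_le h).symm (.congMod ρ)
      else
        cast (Γ.minus_mod_of_ge (Nat.lt_of_not_le h)).symm
          (Γ'.minus_mod_of_ge (Nat.lt_of_not_le h)).symm (ρ.minus (σ - τ))

end Ren

/-- The renamed derivation `Γ' ⊢ J[ρ]`, for `Γ ⊢ J` and `ρ : Γ ⇝ Γ'`. -/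
def Tm.rename {S : Signature.{w}} :
    {Γ : Ctx S.Base} → {J : Judg S.Base} → Tm S Γ J →
      {Γ' : Ctx S.Base} → Ren Γ Γ' → Tm S Γ' J
  | _, _, .var x, _, ρ => .var (ρ.onVar x)
  | _, _, .const f V, _, ρ => .const f (fun i => (V i).rename ρ)
  | _, _, .unit, _, _ => .unit
  | _, _, .pair V W, _, ρ => .pair (V.rename ρ) (W.rename ρ)
  | _, _, .lam M, _, ρ => .lam (M.rename (.congVar ρ))
  | _, _, .box τ V, _, ρ => .box τ (V.rename (.congMod ρ))
  | _, _, .ret V, _, ρ => .ret (V.rename ρ)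
  | _, _, .letIn M N, _, ρ => .letIn (M.rename ρ) (N.rename (.congVar (.congMod ρ)))
  | _, _, .app V W, _, ρ => .app (V.rename ρ) (W.rename ρ)
  | _, _, .split V N, _, ρ => .split (V.rename ρ) (N.rename (.congVar (.congVar ρ)))
  | _, _, .perform o V M, _, ρ => .perform o (V.rename ρ) (M.rename (.congVar (.congMod ρ)))
  | _, _, .delay τ M, _, ρ => .delay τ (M.rename (.congMod ρ))
  | _, _, .handle M H N, _, ρ =>
      .handle (M.rename ρ) (fun o τ'' => (H o τ'').rename (.congVar (.congVar ρ)))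
        (N.rename (.congVar (.congMod ρ)))
  | _, _, .unbox τ h V N, _, ρ =>
      .unbox τ (h.trans ρ.time_le) (V.rename (ρ.minus τ)) (N.rename (.congVar ρ))

/-! ## Models -/

noncomputable section

section Modalities

variable (C : Type u) [Category.{v} C]

/-- A strong monoidal functor `(ℕ, ≤) → [C, C]`, presented as a time-graded comonad with
invertible structure maps. The identifications of grades, such as `0 + τ = τ`, are instances
of `leMap`. -/
structure FutureModality where
  functor : ℕ ⥤ C ⥤ C
  /-- `ε_A : [0] A ≅ A` -/
  counit : functor.obj 0 ≅ 𝟭 C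
  /-- `δ_{A,τ₁,τ₂} : [τ₁ + τ₂] A ≅ [τ₁] ([τ₂] A)` -/
  comult (τ₁ τ₂ : ℕ) : functor.obj (τ₁ + τ₂) ≅ functor.obj τ₂ ⋙ functor.obj τ₁
  comult_counit_left (τ : ℕ) (A : C) :
    (comult 0 τ).hom.app A ≫ counit.hom.app ((functor.obj τ).obj A) =
      (functor.map (homOfLE (Nat.zero_add τ).le)).app A
  comult_counit_right (τ : ℕ) (A : C) :
    (comult τ 0).hom.app A ≫ (functor.obj τ).map (counit.hom.app A) =
      (functor.map (homOfLE (Nat.add_zero τ).le)).app A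
  comult_assoc (τ₁ τ₂ τ₃ : ℕ) (A : C) :
    (comult (τ₁ + τ₂) τ₃).hom.app A ≫ (comult τ₁ τ₂).hom.app ((functor.obj τ₃).obj A) =
      (functor.map (homOfLE (Nat.add_assoc τ₁ τ₂ τ₃).le)).app A ≫
        (comult τ₁ (τ₂ + τ₃)).hom.app A ≫ (functor.obj τ₁).map ((comult τ₂ τ₃).hom.app A)
  comult_mono {τ₁ τ₁' τ₂ τ₂' : ℕ} (h₁ : τ₁ ≤ τ₁') (h₂ : τ₂ ≤ τ₂') (A : C) :
    (functor.map (homOfLE (Nat.add_le_add h₁ h₂))).app A ≫ (comult τ₁' τ₂').hom.app A =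
      (comult τ₁ τ₂).hom.app A ≫
        (functor.map (homOfLE h₁)).app ((functor.obj τ₂).obj A) ≫
          (functor.obj τ₁').map ((functor.map (homOfLE h₂)).app A)

/-- A strong monoidal functor `(ℕ, ≤)ᵒᵖ → [C, C]`, presented as a time-graded monad with
invertible structure maps. -/
structure PastModality where
  functor : ℕᵒᵖ ⥤ C ⥤ C
  /-- `η_A : A ≅ ⟨0⟩ A` -/
  unit : 𝟭 C ≅ functor.obj (.op 0)
  /-- `μ_{A,τ₁,τ₂} : ⟨τ₁⟩ (⟨τ₂⟩ A) ≅ ⟨τ₁ + τ₂⟩ A` -/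
  mult (τ₁ τ₂ : ℕ) :
    functor.obj (.op τ₂) ⋙ functor.obj (.op τ₁) ≅ functor.obj (.op (τ₁ + τ₂))
  unit_mult_left (τ : ℕ) (A : C) :
    unit.hom.app ((functor.obj (.op τ)).obj A) ≫ (mult 0 τ).hom.app A =
      (functor.map (homOfLE (Nat.zero_add τ).le).op).app A
  unit_mult_right (τ : ℕ) (A : C) :
    (functor.obj (.op τ)).map (unit.hom.app A) ≫ (mult τ 0).hom.app A =
      (functor.map (homOfLE (Nat.add_zero τ).le).op).app A
  mult_assoc (τ₁ τ₂ τ₃ : ℕ) (A : C) :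
    (mult τ₁ τ₂).hom.app ((functor.obj (.op τ₃)).obj A) ≫ (mult (τ₁ + τ₂) τ₃).hom.app A =
      (functor.obj (.op τ₁)).map ((mult τ₂ τ₃).hom.app A) ≫ (mult τ₁ (τ₂ + τ₃)).hom.app A ≫
        (functor.map (homOfLE (Nat.add_assoc τ₁ τ₂ τ₃).le).op).app A
  mult_mono {τ₁ τ₁' τ₂ τ₂' : ℕ} (h₁ : τ₁ ≤ τ₁') (h₂ : τ₂ ≤ τ₂') (A : C) :
    (mult τ₁' τ₂').hom.app A ≫ (functor.map (homOfLE (Nat.add_le_add h₁ h₂)).op).app A =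
      (functor.map (homOfLE h₁).op).app ((functor.obj (.op τ₂')).obj A) ≫
        (functor.obj (.op τ₁)).map ((functor.map (homOfLE h₂).op).app A) ≫
          (mult τ₁ τ₂).hom.app A

variable {C}

namespace FutureModality

variable (F : FutureModality C)

/-- The functor `[τ]`. -/
abbrev obj (τ : ℕ) : C ⥤ C := F.functor.obj τ

/-- `[τ ≤ τ']_A : [τ] A → [τ'] A` -/
def leMap {τ τ' : ℕ} (h : τ ≤ τ') (A : C) : (F.obj τ).obj A ⟶ (F.obj τ').obj A :=
  (F.functor.map (homOfLE h)).app A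

/-- `ε_A` -/
def ε (A : C) : (F.obj 0).obj A ⟶ A := F.counit.hom.app A

/-- `ε⁻¹_A` -/
def εInv (A : C) : A ⟶ (F.obj 0).obj A := F.counit.inv.app A

/-- `δ_{A,τ₁,τ₂}` -/
def δ (τ₁ τ₂ : ℕ) (A : C) : (F.obj (τ₁ + τ₂)).obj A ⟶ (F.obj τ₁).obj ((F.obj τ₂).obj A) :=
  (F.comult τ₁ τ₂).hom.app A

/-- `δ⁻¹_{A,τ₁,τ₂}` -/
def δInv (τ₁ τ₂ : ℕ) (A : C) : (F.obj τ₁).obj ((F.obj τ₂).obj A) ⟶ (F.obj (τ₁ + τ₂)).obj A :=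
  (F.comult τ₁ τ₂).inv.app A

end FutureModality

namespace PastModality

variable (P : PastModality C)

/-- The functor `⟨τ⟩`. -/
abbrev obj (τ : ℕ) : C ⥤ C := P.functor.obj (.op τ)

/-- `⟨τ ≤ τ'⟩_A : ⟨τ'⟩ A → ⟨τ⟩ A` -/
def leMap {τ τ' : ℕ} (h : τ ≤ τ') (A : C) : (P.obj τ').obj A ⟶ (P.obj τ).obj A :=
  (P.functor.map (homOfLE h).op).app A

/-- `η_A` -/
def η (A : C) : A ⟶ (P.obj 0).obj A := P.unit.hom.app A

/-- `η⁻¹_A` -/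
def ηInv (A : C) : (P.obj 0).obj A ⟶ A := P.unit.inv.app A

/-- `μ_{A,τ₁,τ₂}` -/
def μ (τ₁ τ₂ : ℕ) (A : C) : (P.obj τ₁).obj ((P.obj τ₂).obj A) ⟶ (P.obj (τ₁ + τ₂)).obj A :=
  (P.mult τ₁ τ₂).hom.app A

/-- `μ⁻¹_{A,τ₁,τ₂}` -/
def μInv (τ₁ τ₂ : ℕ) (A : C) : (P.obj (τ₁ + τ₂)).obj A ⟶ (P.obj τ₁).obj ((P.obj τ₂).obj A) :=
  (P.mult τ₁ τ₂).inv.app A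

/-- The counit-like map `ε^⟨⟩_{A,τ} : ⟨τ⟩ A → ⟨0⟩ A → A`. -/
def toNow (τ : ℕ) (A : C) : (P.obj τ).obj A ⟶ A :=
  P.leMap (Nat.zero_le τ) A ≫ P.ηInv A

end PastModality

variable (C)

/-- The two modalities, with adjunctions `⟨τ⟩ ⊣ [τ]` that interact well with their monoidal
structures. -/
structure Modalities where
  F : FutureModality C
  P : PastModality C
  adj (τ : ℕ) : P.obj τ ⊣ F.obj τ
  unit_zero_le (τ : ℕ) (A : C) :
    F.ε ((P.obj 0).obj A) ≫ P.ηInv A ≫ (adj τ).unit.app A ≫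
        (F.obj τ).map (P.leMap (Nat.zero_le τ) A) =
      F.leMap (Nat.zero_le τ) ((P.obj 0).obj A)
  counit_zero_le (τ : ℕ) (A : C) :
    (adj τ).counit.app A ≫ F.εInv A ≫ P.η ((F.obj 0).obj A) ≫
        (P.obj 0).map (F.leMap (Nat.zero_le τ) A) =
      P.leMap (Nat.zero_le τ) ((F.obj τ).obj A)
  unit_mult (τ₁ τ₂ : ℕ) (A : C) :
    (adj τ₁).unit.app A ≫ (F.obj τ₁).map ((adj τ₂).unit.app ((P.obj τ₁).obj A)) ≫
        (F.obj τ₁).map ((F.obj τ₂).map (P.μ τ₂ τ₁ A)) =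
      (adj (τ₁ + τ₂)).unit.app A ≫ F.δ τ₁ τ₂ ((P.obj (τ₁ + τ₂)).obj A) ≫
        (F.obj τ₁).map ((F.obj τ₂).map (P.leMap (Nat.add_comm τ₂ τ₁).le A))
  counit_comult (τ₁ τ₂ : ℕ) (A : C) :
    (P.obj τ₁).map ((P.obj τ₂).map (F.leMap (Nat.add_comm τ₁ τ₂).le A)) ≫
        (P.obj τ₁).map ((P.obj τ₂).map (F.δ τ₂ τ₁ A)) ≫
          (P.obj τ₁).map ((adj τ₂).counit.app ((F.obj τ₁).obj A)) ≫ (adj τ₁).counit.app A =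
      P.μ τ₁ τ₂ ((F.obj (τ₁ + τ₂)).obj A) ≫ (adj (τ₁ + τ₂)).counit.app A

end Modalities

variable {C : Type u} [Category.{v} C] [CartesianMonoidalCategory C]

/-- The canonical map `[τ] A × [τ] B → [τ] (A × B)`, inverse to the comparison map of the right
adjoint `[τ]`. -/
def Modalities.prodMap (K : Modalities C) (τ : ℕ) (A B : C) :
    (K.F.obj τ).obj A ⊗ (K.F.obj τ).obj B ⟶ (K.F.obj τ).obj (A ⊗ B) :=
  (K.adj τ).homEquiv _ _
    (lift ((K.P.obj τ).map (fst _ _) ≫ (K.adj τ).counit.app A)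
      ((K.P.obj τ).map (snd _ _) ≫ (K.adj τ).counit.app B))

/-- The identification `T τ A = T τ' A` for equal grades. -/
def gradeCast (T : ℕ → C ⥤ C) {τ τ' : ℕ} (h : τ = τ') (A : C) : (T τ).obj A ⟶ (T τ').obj A :=
  eqToHom (by rw [h])

variable (C) in
/-- The modalities together with a `[-]`-strong graded monad `T`. -/
structure GradedModel extends Modalities C where
  T : ℕ → C ⥤ C
  ηT : 𝟭 C ⟶ T 0
  /-- `μ^T_{A,τ₁,τ₂} : T τ₁ (T τ₂ A) → T (τ₁ + τ₂) A` -/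
  μT (τ₁ τ₂ : ℕ) : T τ₂ ⋙ T τ₁ ⟶ T (τ₁ + τ₂)
  /-- `str_{A,B,τ} : [τ] A × T τ B → T τ (A × B)` -/
  str (τ : ℕ) (A B : C) : (F.obj τ).obj A ⊗ (T τ).obj B ⟶ (T τ).obj (A ⊗ B)
  str_natural (τ : ℕ) {A A' B B' : C} (f : A ⟶ A') (g : B ⟶ B') :
    ((F.obj τ).map f ⊗ₘ (T τ).map g) ≫ str τ A' B' = str τ A B ≫ (T τ).map (f ⊗ₘ g)
  ηT_μT_left (τ : ℕ) (A : C) :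
    ηT.app ((T τ).obj A) ≫ (μT 0 τ).app A = gradeCast T (Nat.zero_add τ).symm A
  ηT_μT_right (τ : ℕ) (A : C) :
    (T τ).map (ηT.app A) ≫ (μT τ 0).app A = gradeCast T (Nat.add_zero τ).symm A
  μT_assoc (τ₁ τ₂ τ₃ : ℕ) (A : C) :
    (μT τ₁ τ₂).app ((T τ₃).obj A) ≫ (μT (τ₁ + τ₂) τ₃).app A ≫
        gradeCast T (Nat.add_assoc τ₁ τ₂ τ₃) A =
      (T τ₁).map ((μT τ₂ τ₃).app A) ≫ (μT τ₁ (τ₂ + τ₃)).app A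
  str_ηT (A B : C) : (F.εInv A ⊗ₘ ηT.app B) ≫ str 0 A B = ηT.app (A ⊗ B)
  str_snd (τ : ℕ) (A B : C) : str τ A B ≫ (T τ).map (snd A B) = snd _ _
  str_μT (τ₁ τ₂ : ℕ) (A B : C) :
    str τ₁ ((F.obj τ₂).obj A) ((T τ₂).obj B) ≫ (T τ₁).map (str τ₂ A B) ≫
        (μT τ₁ τ₂).app (A ⊗ B) =
      (F.δInv τ₁ τ₂ A ⊗ₘ (μT τ₁ τ₂).app B) ≫ str (τ₁ + τ₂) A B
  str_assoc (τ : ℕ) (A B D : C) :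
    (α_ ((F.obj τ).obj A) ((F.obj τ).obj B) ((T τ).obj D)).inv ≫
        (toModalities.prodMap τ A B ▷ (T τ).obj D) ≫ str τ (A ⊗ B) D ≫
          (T τ).map (α_ A B D).hom =
      ((F.obj τ).obj A ◁ str τ B D) ≫ str τ A (B ⊗ D)

variable [MonoidalClosed C]

/-- The exponential `A ⇒ B`. -/
abbrev expo (A B : C) : C := (ihom A).obj B

/-- Currying of the second factor. -/
def cur {Z X Y : C} (f : Z ⊗ X ⟶ Y) : Z ⟶ expo X Y :=
  MonoidalClosed.curry (lift (snd X Z) (fst X Z) ≫ f)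

/-- Uncurrying of the second factor. -/
def unc {Z X Y : C} (f : Z ⟶ expo X Y) : Z ⊗ X ⟶ Y :=
  lift (snd Z X) (fst Z X) ≫ MonoidalClosed.uncurry f

/-- The map `X × (B ⇒ Y) → (B ⇒ X × Y)`. -/
def pushUnder (X B Y : C) : X ⊗ expo B Y ⟶ expo B (X ⊗ Y) :=
  cur ((α_ X (expo B Y) B).hom ≫ (X ◁ unc (𝟙 (expo B Y))))

/-- The interpretation of value types, given the interpretation of base types. On ground types
it uses only the finite products and the functors `[τ]`. -/
def Ty.sem (G : GradedModel C) {B : Type w} (b : B → C) : Ty B → C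
  | .base β => b β
  | .unit => 𝟙_ C
  | .prod X Y => X.sem G b ⊗ Y.sem G b
  | .fn X Y τ => expo (X.sem G b) ((G.T τ).obj (Y.sem G b))
  | .box τ X => (G.F.obj τ).obj (X.sem G b)

/-- The product `X₀ × (X₁ × … × 1)` of a finite family. -/
def finProd : (n : ℕ) → (Fin n → C) → C
  | 0, _ => 𝟙_ C
  | n + 1, X => X 0 ⊗ finProd n (fun i => X i.succ)

/-- The tuple `⟨f₀, f₁, …⟩`. -/
def finLift {Z : C} : (n : ℕ) → (X : Fin n → C) → ((i : Fin n) → (Z ⟶ X i)) → (Z ⟶ finProd n X)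
  | 0, _, _ => toUnit Z
  | n + 1, X, f => lift (f 0) (finLift n (fun i => X i.succ) (fun i => f i.succ))

section Model

variable (S : Signature.{w}) [HasProductsOfShape S.Op C] [HasProductsOfShape ℕ C]

/-- The object `(A_op × [τ_op] (B_op ⇒ T τ A)) ⇒ T (τ_op + τ) A` of operation clauses. -/
abbrev clauseObj (G : GradedModel C) (b : S.Base → C) (A : C) (o : S.Op) (τ : ℕ) : C :=
  expo
    ((S.param o).toTy.sem G b ⊗
      (G.F.obj (S.time o)).obj (expo ((S.result o).toTy.sem G b) ((G.T τ).obj A)))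
    ((G.T (S.time o + τ)).obj A)

/-- The domain `∏_op ∏_τ ((A_op × [τ_op] (B_op ⇒ T τ A)) ⇒ T (τ_op + τ) A)` of the handling
morphisms. -/
abbrev handlerObj (G : GradedModel C) (b : S.Base → C) (A : C) : C :=
  ∏ᶜ fun o : S.Op => ∏ᶜ fun τ : ℕ => clauseObj S G b A o τ

variable (C) in
/-- The abstract model structure. -/
structure Model extends GradedModel C where
  base : S.Base → C
  const (f : S.Const) :
    finProd (S.arity f) (fun i => (S.constDom f i).toTy.sem toGradedModel base) ⟶
      (S.constCod f).toTy.sem toGradedModel base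
  /-- `op_{A,τ} : A_op × [τ_op] (B_op ⇒ T τ A) → T (τ_op + τ) A` -/
  opT (o : S.Op) (τ : ℕ) (A : C) :
    (S.param o).toTy.sem toGradedModel base ⊗
        (F.obj (S.time o)).obj (expo ((S.result o).toTy.sem toGradedModel base) ((T τ).obj A)) ⟶
      (T (S.time o + τ)).obj A
  opT_natural (o : S.Op) (τ : ℕ) {A A' : C} (f : A ⟶ A') :
    (_ ◁ (F.obj (S.time o)).map ((ihom _).map ((T τ).map f))) ≫ opT o τ A' =
      opT o τ A ≫ (T (S.time o + τ)).map f
  /-- `delay_{A,τ'} τ : [τ] (T τ' A) → T (τ + τ') A` -/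
  delayT (τ τ' : ℕ) : T τ' ⋙ F.obj τ ⟶ T (τ + τ')
  opT_μT (o : S.Op) (τ τ' : ℕ) (A : C) :
    opT o τ ((T τ').obj A) ≫ (μT (S.time o + τ) τ').app A =
      (_ ◁ (F.obj (S.time o)).map ((ihom _).map ((μT τ τ').app A))) ≫ opT o (τ + τ') A ≫
        gradeCast T (Nat.add_assoc (S.time o) τ τ').symm A
  delayT_μT (τ τ' τ'' : ℕ) (A : C) :
    (delayT τ τ').app ((T τ'').obj A) ≫ (μT (τ + τ') τ'').app A =
      (F.obj τ).map ((μT τ' τ'').app A) ≫ (delayT τ (τ' + τ'')).app A ≫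
        gradeCast T (Nat.add_assoc τ τ' τ'').symm A
  opT_str (o : S.Op) (τ : ℕ) (A B : C) :
    ((F.obj (S.time o + τ)).obj A ◁ opT o τ B) ≫ str (S.time o + τ) A B =
      lift (snd _ _ ≫ fst _ _)
          (lift (fst _ _ ≫ F.δ (S.time o) τ A) (snd _ _ ≫ snd _ _) ≫
            toModalities.prodMap (S.time o) ((F.obj τ).obj A)
                (expo ((S.result o).toTy.sem toGradedModel base) ((T τ).obj B)) ≫
              (F.obj (S.time o)).map (pushUnder _ _ _ ≫ (ihom _).map (str τ A B))) ≫
        opT o τ (A ⊗ B)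
  delayT_str (τ τ' : ℕ) (A B : C) :
    ((F.obj (τ + τ')).obj A ◁ (delayT τ τ').app B) ≫ str (τ + τ') A B =
      (F.δ τ τ' A ▷ (F.obj τ).obj ((T τ').obj B)) ≫
        toModalities.prodMap τ ((F.obj τ').obj A) ((T τ').obj B) ≫
          (F.obj τ).map (str τ' A B) ≫ (delayT τ τ').app (A ⊗ B)
  /-- The handling morphisms. -/
  h (τ τ' : ℕ) (A : C) :
    handlerObj S toGradedModel base A ⟶ expo ((T τ).obj ((T τ').obj A)) ((T (τ + τ')).obj A)
  h_ηT (τ : ℕ) (A : C) :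
    (handlerObj S toGradedModel base A ◁ ηT.app ((T τ).obj A)) ≫ unc (h 0 τ A) =
      snd _ _ ≫ gradeCast T (Nat.zero_add τ).symm A
  h_delayT (τ τ' τ'' : ℕ) (A : C) :
    (handlerObj S toGradedModel base A ◁ (delayT τ τ').app ((T τ'').obj A)) ≫
        unc (h (τ + τ') τ'' A) =
      ((adj τ).unit.app (handlerObj S toGradedModel base A) ▷ _) ≫
        toModalities.prodMap τ ((P.obj τ).obj (handlerObj S toGradedModel base A))
            ((T τ').obj ((T τ'').obj A)) ≫
          (F.obj τ).map (P.toNow τ (handlerObj S toGradedModel base A) ▷ _) ≫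
            (F.obj τ).map (unc (h τ' τ'' A)) ≫ (delayT τ (τ' + τ'')).app A ≫
              gradeCast T (Nat.add_assoc τ τ' τ'').symm A
  h_opT (o : S.Op) (τ τ' : ℕ) (A : C) :
    (handlerObj S toGradedModel base A ◁ opT o τ ((T τ').obj A)) ≫
        unc (h (S.time o + τ) τ' A) =
      lift
          (fst _ _ ≫ Pi.π (fun o : S.Op => ∏ᶜ fun τ : ℕ => clauseObj S toGradedModel base A o τ) o ≫
            Pi.π (fun τ : ℕ => clauseObj S toGradedModel base A o τ) (τ + τ'))
          (lift (snd _ _ ≫ fst _ _)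
            (lift (fst _ _ ≫ (adj (S.time o)).unit.app (handlerObj S toGradedModel base A))
                (snd _ _ ≫ snd _ _) ≫
              toModalities.prodMap (S.time o)
                  ((P.obj (S.time o)).obj (handlerObj S toGradedModel base A))
                  (expo ((S.result o).toTy.sem toGradedModel base)
                    ((T τ).obj ((T τ').obj A))) ≫
                (F.obj (S.time o)).map
                  ((P.toNow (S.time o) (handlerObj S toGradedModel base A) ▷ _) ≫
                    pushUnder _ _ _ ≫ (ihom _).map (unc (h τ τ' A))))) ≫
        unc (𝟙 (clauseObj S toGradedModel base A o (τ + τ'))) ≫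
          gradeCast T (Nat.add_assoc (S.time o) τ τ').symm A

end Model

/-! ## Interpretation -/

variable {S : Signature.{w}} [HasProductsOfShape S.Op C] [HasProductsOfShape ℕ C]

namespace Model

variable (M : Model C S)

/-- The interpretation `⟦X⟧` of a value type. -/
abbrev ty (X : Ty S.Base) : C := X.sem M.toGradedModel M.base

/-- The interpretation of contexts as functors. -/
@[reducible] def ctx : Ctx S.Base → C ⥤ C
  | .nil => 𝟭 C
  | .var Γ X => ctx Γ ⋙ tensorRight (M.ty X)
  | .mod Γ τ => ctx Γ ⋙ M.P.obj τ

/-- The codomain `⟦X⟧` or `T τ ⟦X⟧` of the denotation of a derivation. -/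
@[reducible] def judg : Judg S.Base → C
  | .val X => M.ty X
  | .comp X τ => (M.T τ).obj (M.ty X)

/-- The identification of the interpretations of equal contexts. -/
def ctxCast {Γ Γ' : Ctx S.Base} (h : Γ = Γ') (A : C) : (M.ctx Γ).obj A ⟶ (M.ctx Γ').obj A :=
  eqToHom (by rw [h])

/-- The map `⟦Γ₁, x : X, Γ₂⟧ A → ⟦Γ₂⟧ (⟦Γ₁⟧ A × ⟦X⟧)`. -/
def iota : {Γ : Ctx S.Base} → {X : Ty S.Base} → (x : Var Γ X) → (A : C) →
    ((M.ctx Γ).obj A ⟶ (M.ctx x.right).obj ((M.ctx x.left).obj A ⊗ M.ty X))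
  | _, _, .here, _ => 𝟙 _
  | _, _, .skipVar (Y := Y) x, A => iota x A ▷ M.ty Y
  | _, _, .skipMod (τ := τ) x, A => (M.P.obj τ).map (iota x A)

/-- The map `e_{A,Γ} : ⟦Γ⟧ A → ⟨time Γ⟩ A`, which collapses the modalities in `Γ`. -/
def collapse : (Γ : Ctx S.Base) → (A : C) → ((M.ctx Γ).obj A ⟶ (M.P.obj Γ.time).obj A)
  | .nil, A => M.P.η A
  | .var Γ _, A => fst _ _ ≫ collapse Γ A
  | .mod Γ τ, A =>
      (M.P.obj τ).map (collapse Γ A) ≫ M.P.μ τ Γ.time A ≫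
        M.P.leMap (Nat.add_comm Γ.time τ).le A

/-- The interpretation `⟦Γ⟧ A → ⟦X⟧` of a variable. -/
def var {Γ : Ctx S.Base} {X : Ty S.Base} (x : Var Γ X) (A : C) : (M.ctx Γ).obj A ⟶ M.ty X :=
  M.iota x A ≫ M.collapse x.right _ ≫ M.P.toNow x.right.time _ ≫ snd _ _

/-- The map `η^PRA_{Γ,A,τ} : ⟦Γ⟧ A → ⟨τ⟩ (⟦Γ - τ⟧ A)`, which collapses `τ` worth of modalities
in `Γ`. -/
def etaPRA : (Γ : Ctx S.Base) → (τ : ℕ) → τ ≤ Γ.time → (A : C) →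
    ((M.ctx Γ).obj A ⟶ (M.P.obj τ).obj ((M.ctx (Γ.minus τ)).obj A))
  | Γ, 0, _, A => M.P.η _ ≫ (M.P.obj 0).map (M.ctxCast Γ.minus_zero.symm A)
  | .nil, _ + 1, h, _ => absurd h (Nat.not_succ_le_zero _)
  | .var Γ _, τ + 1, h, A => fst _ _ ≫ etaPRA Γ (τ + 1) h A
  | .mod Γ τ', τ + 1, h, A =>
      if hle : τ + 1 ≤ τ' then
        M.P.leMap (Nat.add_sub_cancel' hle).le ((M.ctx Γ).obj A) ≫
          M.P.μInv (τ + 1) (τ' - (τ + 1)) ((M.ctx Γ).obj A) ≫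
            (M.P.obj (τ + 1)).map (M.ctxCast (Γ.minus_mod_of_le hle).symm A)
      else
        (M.P.obj τ').map
            (etaPRA Γ (τ + 1 - τ') (Nat.sub_le_iff_le_add.mpr h) A) ≫
          M.P.μ τ' (τ + 1 - τ') _ ≫
            M.P.leMap (Nat.add_sub_cancel' (Nat.lt_of_not_le hle).le).ge _ ≫
              (M.P.obj (τ + 1)).map
                (M.ctxCast (Γ.minus_mod_of_ge (Nat.lt_of_not_le hle)).symm A)

/-- The interpretation `⟦ρ⟧_A : ⟦Γ'⟧ A → ⟦Γ⟧ A` of a renaming `ρ : Γ ⇝ Γ'`. -/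
def ren : {Γ Γ' : Ctx S.Base} → Ren Γ Γ' → (A : C) → ((M.ctx Γ').obj A ⟶ (M.ctx Γ).obj A)
  | _, _, .id, _ => 𝟙 _
  | _, _, .comp ρ' ρ, A => ren ρ' A ≫ ren ρ A
  | _, _, .wk, _ => fst _ _
  | _, _, .var x, A => lift (𝟙 _) (M.var x A)
  | _, _, .eta (Γ := Γ), A => M.P.η ((M.ctx Γ).obj A)
  | _, _, .etaInv (Γ := Γ), A => M.P.ηInv ((M.ctx Γ).obj A)
  | _, _, .mu (Γ := Γ) τ τ', A =>
      M.P.μ τ' τ ((M.ctx Γ).obj A) ≫ M.P.leMap (Nat.add_comm τ τ').le ((M.ctx Γ).obj A)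
  | _, _, .muInv (Γ := Γ) τ τ', A =>
      M.P.leMap (Nat.add_comm τ' τ).le ((M.ctx Γ).obj A) ≫ M.P.μInv τ' τ ((M.ctx Γ).obj A)
  | _, _, .mon (Γ := Γ) h, A => M.P.leMap h ((M.ctx Γ).obj A)
  | _, _, .congVar (X := X) ρ, A => ren ρ A ▷ M.ty X
  | _, _, .congMod (τ := τ) ρ, A => (M.P.obj τ).map (ren ρ A)

/-- The interpretation of derivations `Γ ⊢ J` as morphisms `⟦Γ⟧ 1 → ⟦X⟧` or
`⟦Γ⟧ 1 → T τ ⟦X⟧`. -/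
def tm : {Γ : Ctx S.Base} → {J : Judg S.Base} → Tm S Γ J →
    ((M.ctx Γ).obj (𝟙_ C) ⟶ M.judg J)
  | _, _, .var x => M.var x (𝟙_ C)
  | _, _, .const f V => finLift (S.arity f) _ (fun i => tm (V i)) ≫ M.const f
  | _, _, .unit => toUnit _
  | _, _, .pair V W => lift (tm V) (tm W)
  | _, _, .lam N => cur (tm N)
  | _, _, .box τ V => (M.adj τ).unit.app _ ≫ (M.F.obj τ).map (tm V)
  | _, _, .ret (X := X) V => tm V ≫ M.ηT.app (M.ty X)
  | _, _, .letIn (Γ := Γ) (X := X) (Y := Y) (τ := τ) (τ' := τ') N N' =>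
      lift ((M.adj τ).unit.app ((M.ctx Γ).obj (𝟙_ C))) (tm N) ≫
        M.str τ ((M.P.obj τ).obj ((M.ctx Γ).obj (𝟙_ C))) (M.ty X) ≫
          (M.T τ).map (tm N') ≫ (M.μT τ τ').app (M.ty Y)
  | _, _, .app (X := X) (Y := Y) (τ := τ) V W =>
      lift (tm V) (tm W) ≫ unc (𝟙 (expo (M.ty X) ((M.T τ).obj (M.ty Y))))
  | _, _, .split (Γ := Γ) (X := X) (Y := Y) V N =>
      lift (𝟙 ((M.ctx Γ).obj (𝟙_ C))) (tm V) ≫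
        (α_ ((M.ctx Γ).obj (𝟙_ C)) (M.ty X) (M.ty Y)).inv ≫ tm N
  | _, _, .perform (Γ := Γ) (X := X) (τ := τ) o V N =>
      lift (tm V) ((M.adj (S.time o)).unit.app ((M.ctx Γ).obj (𝟙_ C))) ≫
        (M.ty (S.param o).toTy ◁ (M.F.obj (S.time o)).map (cur (tm N))) ≫
          M.opT o τ (M.ty X)
  | _, _, .delay (Γ := Γ) (X := X) (τ' := τ') τ N =>
      (M.adj τ).unit.app ((M.ctx Γ).obj (𝟙_ C)) ≫ (M.F.obj τ).map (tm N) ≫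
        (M.delayT τ τ').app (M.ty X)
  | _, _, .handle (Γ := Γ) (X := X) (Y := Y) (τ := τ) (τ' := τ') N H N' =>
      lift (𝟙 ((M.ctx Γ).obj (𝟙_ C)))
          (lift ((M.adj τ).unit.app ((M.ctx Γ).obj (𝟙_ C))) (tm N)) ≫
        (_ ◁ M.str τ ((M.P.obj τ).obj ((M.ctx Γ).obj (𝟙_ C))) (M.ty X)) ≫
          (_ ◁ (M.T τ).map (tm N')) ≫
            ((Pi.lift (fun _ : S.Op => Pi.lift (fun _ : ℕ => 𝟙 ((M.ctx Γ).obj (𝟙_ C)))) ≫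
                Limits.Pi.map (fun o : S.Op => Limits.Pi.map (fun τ'' : ℕ =>
                  (cur ((α_ _ _ _).inv ≫ tm (H o τ'')) :
                    _ ⟶ clauseObj S M.toGradedModel M.base (M.ty Y) o τ'')))) ▷ _) ≫
              unc (M.h τ τ' (M.ty Y))
  | _, _, .unbox (Γ := Γ) (X := X) τ h V N =>
      lift (𝟙 ((M.ctx Γ).obj (𝟙_ C))) (M.etaPRA Γ τ h (𝟙_ C)) ≫
        (_ ◁ (M.P.obj τ).map (tm V)) ≫
          (_ ◁ (M.adj τ).counit.app (M.ty X)) ≫ tm N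

end Model

end

end LambdaTau

open LambdaTau

/-!
Each renaming `ρ : Γ ⇝ Γ'` denotes a natural transformation `⟦Γ'⟧ ⟶ ⟦Γ⟧`, because each generator
is sent to one of the structure maps of the model, and these are natural (`Model.ctx_map_ren`).

That renaming a derivation is precomposition with `⟦ρ⟧` follows by induction on the derivation
(`Model.tm_rename`). In each case the semantic operation commutes with precomposition, by naturality
of pairing, currying, the unit of `⟨τ⟩ ⊣ [τ]` and the strength of `T`, and by the congruences of
renamings denoting the functorial actions of `_ × ⟦X⟧` and `⟨τ⟩`. Two cases carry content.

* For variables, `⟦x⟧` satisfies a recursion on `x` in which passing a variable is a projection and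
  passing a modality is the map `⟨τ⟩ A → A` (`Model.var_skipVar`, `Model.var_skipMod`). Compatibility
  with `ρ` (`Model.ren_var`) is then a check on generators.
* For `unbox`, the value is typed in `Γ - σ`, and one needs
  `⟦ρ⟧ ≫ η^PRA_Γ = η^PRA_Γ' ≫ ⟨σ⟩ ⟦ρ - σ⟧` (`Model.ren_etaPRA`), by induction on `ρ`. The generator
  `⟨τ⟩ ⇝ ⟨τ'⟩` for `τ ≤ τ'` is the delicate one: the larger modality leaves less time to
  take out of the context to its left. It rests on two facts about a fixed context: forgetting all of the collected time
  gives `⟦Γ - σ ⇝ Γ⟧` (`Model.etaPRA_toNow`), and forgetting a part of it gives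
  `⟦Γ - σ₂ ⇝ Γ - σ₁⟧` for `σ₁ ≤ σ₂` (`Model.etaPRA_minusMono`).

All the maps between iterated modalities that occur are instances of `PastModality.merge` and
`PastModality.slice`, which compose as the laws of a strong monoidal functor on the thin category
`(ℕ, ≤)ᵒᵖ` prescribe.
-/

namespace LambdaTau

/-! ### Coherence for the modality of elapsed time -/

namespace PastModality

variable {C : Type u} [Category.{v} C] (P : PastModality C)

theorem leMap_natural {τ τ' : ℕ} (h : τ ≤ τ') {A B : C} (f : A ⟶ B) :
    (P.obj τ').map f ≫ P.leMap h B = P.leMap h A ≫ (P.obj τ).map f :=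
  (P.functor.map (homOfLE h).op).naturality f

@[simp]
theorem leMap_refl {τ : ℕ} (h : τ ≤ τ) (A : C) : P.leMap h A = 𝟙 _ := by
  simp [leMap]

@[simp]
theorem leMap_leMap {τ₁ τ₂ τ₃ : ℕ} (h : τ₁ ≤ τ₂) (h' : τ₂ ≤ τ₃) (A : C) :
    P.leMap h' A ≫ P.leMap h A = P.leMap (h.trans h') A := by
  simp only [leMap, ← NatTrans.comp_app, ← Functor.map_comp]
  rfl

@[simp]
theorem leMap_leMap_assoc {τ₁ τ₂ τ₃ : ℕ} (h : τ₁ ≤ τ₂) (h' : τ₂ ≤ τ₃) (A : C) {Z : C}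
    (f : (P.obj τ₁).obj A ⟶ Z) :
    P.leMap h' A ≫ P.leMap h A ≫ f = P.leMap (h.trans h') A ≫ f := by
  rw [← Category.assoc, leMap_leMap]

@[simp]
theorem η_ηInv (A : C) : P.η A ≫ P.ηInv A = 𝟙 A := P.unit.hom_inv_id_app A

@[simp]
theorem ηInv_η (A : C) : P.ηInv A ≫ P.η A = 𝟙 _ := P.unit.inv_hom_id_app A

@[simp]
theorem μ_μInv (τ₁ τ₂ : ℕ) (A : C) : P.μ τ₁ τ₂ A ≫ P.μInv τ₁ τ₂ A = 𝟙 _ :=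
  (P.mult τ₁ τ₂).hom_inv_id_app A

@[simp]
theorem μInv_μ (τ₁ τ₂ : ℕ) (A : C) : P.μInv τ₁ τ₂ A ≫ P.μ τ₁ τ₂ A = 𝟙 _ :=
  (P.mult τ₁ τ₂).inv_hom_id_app A

theorem η_natural {A B : C} (f : A ⟶ B) : f ≫ P.η B = P.η A ≫ (P.obj 0).map f :=
  P.unit.hom.naturality f

theorem ηInv_natural {A B : C} (f : A ⟶ B) : (P.obj 0).map f ≫ P.ηInv B = P.ηInv A ≫ f :=
  P.unit.inv.naturality f

theorem μ_natural (τ₁ τ₂ : ℕ) {A B : C} (f : A ⟶ B) :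
    (P.obj τ₁).map ((P.obj τ₂).map f) ≫ P.μ τ₁ τ₂ B = P.μ τ₁ τ₂ A ≫ (P.obj (τ₁ + τ₂)).map f :=
  (P.mult τ₁ τ₂).hom.naturality f

theorem μInv_natural (τ₁ τ₂ : ℕ) {A B : C} (f : A ⟶ B) :
    (P.obj (τ₁ + τ₂)).map f ≫ P.μInv τ₁ τ₂ B =
      P.μInv τ₁ τ₂ A ≫ (P.obj τ₁).map ((P.obj τ₂).map f) :=
  (P.mult τ₁ τ₂).inv.naturality f

theorem toNow_natural (τ : ℕ) {A B : C} (f : A ⟶ B) :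
    (P.obj τ).map f ≫ P.toNow τ B = P.toNow τ A ≫ f := by
  rw [toNow, toNow, reassoc_of% P.leMap_natural, ηInv_natural, Category.assoc]

@[simp]
theorem leMap_toNow {τ τ' : ℕ} (h : τ ≤ τ') (A : C) :
    P.leMap h A ≫ P.toNow τ A = P.toNow τ' A := by
  simp [toNow]

@[simp]
theorem η_toNow (A : C) : P.η A ≫ P.toNow 0 A = 𝟙 A := by
  simp [toNow]

/-- The map `⟨τ₁⟩ (⟨τ₂⟩ A) → ⟨τ⟩ A` for `τ ≤ τ₁ + τ₂`. Carrying the inequality as an argument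
makes identifications of grades disappear from the equations between such maps. -/
def merge {τ₁ τ₂ τ : ℕ} (h : τ ≤ τ₁ + τ₂) (A : C) :
    (P.obj τ₁).obj ((P.obj τ₂).obj A) ⟶ (P.obj τ).obj A :=
  P.μ τ₁ τ₂ A ≫ P.leMap h A

/-- The map `⟨τ⟩ A → ⟨τ₁⟩ (⟨τ₂⟩ A)` for `τ₁ + τ₂ ≤ τ`. -/
def slice {τ₁ τ₂ τ : ℕ} (h : τ₁ + τ₂ ≤ τ) (A : C) :
    (P.obj τ).obj A ⟶ (P.obj τ₁).obj ((P.obj τ₂).obj A) :=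
  P.leMap h A ≫ P.μInv τ₁ τ₂ A

theorem merge_natural {τ₁ τ₂ τ : ℕ} (h : τ ≤ τ₁ + τ₂) {A B : C} (f : A ⟶ B) :
    (P.obj τ₁).map ((P.obj τ₂).map f) ≫ P.merge h B = P.merge h A ≫ (P.obj τ).map f := by
  rw [merge, merge, reassoc_of% P.μ_natural, leMap_natural, Category.assoc]

theorem slice_natural {τ₁ τ₂ τ : ℕ} (h : τ₁ + τ₂ ≤ τ) {A B : C} (f : A ⟶ B) :
    (P.obj τ).map f ≫ P.slice h B = P.slice h A ≫ (P.obj τ₁).map ((P.obj τ₂).map f) := by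
  rw [slice, slice, reassoc_of% P.leMap_natural, μInv_natural, Category.assoc]

@[simp]
theorem slice_merge {τ₁ τ₂ τ τ' : ℕ} (h : τ₁ + τ₂ ≤ τ) (h' : τ' ≤ τ₁ + τ₂) (A : C) :
    P.slice h A ≫ P.merge h' A = P.leMap (h'.trans h) A := by
  rw [slice, merge, Category.assoc, reassoc_of% P.μInv_μ, leMap_leMap]

theorem merge_slice {τ₁ τ₂ : ℕ} (A : C) :
    P.merge (le_refl (τ₁ + τ₂)) A ≫ P.slice le_rfl A = 𝟙 _ := by
  simp [slice, merge]

/-- Maps into `⟨τ₁⟩ (⟨τ₂⟩ A)` may be compared after merging the two modalities. -/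
theorem hom_ext_merge {τ₁ τ₂ : ℕ} {A Z : C} {f g : Z ⟶ (P.obj τ₁).obj ((P.obj τ₂).obj A)}
    (h : f ≫ P.merge (le_refl (τ₁ + τ₂)) A = g ≫ P.merge (le_refl (τ₁ + τ₂)) A) : f = g := by
  have := congrArg (· ≫ P.slice le_rfl A) h
  simpa [merge_slice] using this

@[simp]
theorem merge_leMap {τ₁ τ₂ τ τ' : ℕ} (h : τ ≤ τ₁ + τ₂) (h' : τ' ≤ τ) (A : C) :
    P.merge h A ≫ P.leMap h' A = P.merge (h'.trans h) A := by
  simp [merge]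

theorem leMap_merge {τ₁ τ₁' τ₂ τ : ℕ} (h₁ : τ₁ ≤ τ₁') (h : τ ≤ τ₁ + τ₂) (A : C) :
    P.leMap h₁ ((P.obj τ₂).obj A) ≫ P.merge h A =
      P.merge (h.trans (Nat.add_le_add_right h₁ _)) A := by
  have := P.mult_mono h₁ (le_refl τ₂) A
  change P.μ _ _ A ≫ P.leMap _ A = P.leMap _ _ ≫ (P.obj τ₁).map (P.leMap _ A) ≫ P.μ _ _ A at this
  rw [leMap_refl, (P.obj τ₁).map_id, Category.id_comp] at this
  rw [merge, ← reassoc_of% this, leMap_leMap, merge]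

theorem map_leMap_merge {τ₁ τ₂ τ₂' τ : ℕ} (h₂ : τ₂ ≤ τ₂') (h : τ ≤ τ₁ + τ₂) (A : C) :
    (P.obj τ₁).map (P.leMap h₂ A) ≫ P.merge h A =
      P.merge (h.trans (Nat.add_le_add_left h₂ _)) A := by
  have := P.mult_mono (le_refl τ₁) h₂ A
  change P.μ _ _ A ≫ P.leMap _ A = P.leMap _ _ ≫ (P.obj τ₁).map (P.leMap _ A) ≫ P.μ _ _ A at this
  rw [P.leMap_refl (τ := τ₁), Category.id_comp] at this
  rw [merge, ← reassoc_of% this, leMap_leMap, merge]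

theorem merge_assoc {τ₁ τ₂ τ₃ τ₁₂ τ₂₃ τ : ℕ} (h₁₂ : τ₁₂ ≤ τ₁ + τ₂) (h₂₃ : τ₂₃ ≤ τ₂ + τ₃)
    (h : τ ≤ τ₁₂ + τ₃) (h' : τ ≤ τ₁ + τ₂₃) (A : C) :
    P.merge h₁₂ ((P.obj τ₃).obj A) ≫ P.merge h A =
      (P.obj τ₁).map (P.merge h₂₃ A) ≫ P.merge h' A := by
  have := P.mult_assoc τ₁ τ₂ τ₃ A
  change P.μ _ _ _ ≫ P.μ _ _ A = (P.obj τ₁).map (P.μ _ _ A) ≫ P.μ _ _ A ≫ P.leMap _ A at this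
  have hL : P.merge h₁₂ ((P.obj τ₃).obj A) ≫ P.merge h A =
      P.μ τ₁ τ₂ _ ≫ P.μ (τ₁ + τ₂) τ₃ A ≫
        P.leMap (h.trans (Nat.add_le_add_right h₁₂ τ₃)) A := by
    rw [merge, Category.assoc, leMap_merge, merge]
  have hR : (P.obj τ₁).map (P.merge h₂₃ A) ≫ P.merge h' A =
      (P.obj τ₁).map (P.μ τ₂ τ₃ A) ≫ P.μ τ₁ (τ₂ + τ₃) A ≫
        P.leMap (h'.trans (Nat.add_le_add_left h₂₃ τ₁)) A := by
    rw [merge, Functor.map_comp, Category.assoc, map_leMap_merge, merge]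
  rw [hL, hR, reassoc_of% this, leMap_leMap]

theorem η_merge {τ τ' : ℕ} (h : τ' ≤ 0 + τ) (A : C) :
    P.η ((P.obj τ).obj A) ≫ P.merge h A = P.leMap (h.trans (Nat.zero_add τ).le) A := by
  have := P.unit_mult_left τ A
  change P.η _ ≫ P.μ _ _ A = P.leMap _ A at this
  rw [merge, reassoc_of% this, leMap_leMap]

theorem map_η_merge {τ τ' : ℕ} (h : τ' ≤ τ + 0) (A : C) :
    (P.obj τ).map (P.η A) ≫ P.merge h A = P.leMap h A := by
  have := P.unit_mult_right τ A
  change (P.obj τ).map (P.η _) ≫ P.μ _ _ A = P.leMap _ A at this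
  rw [merge, reassoc_of% this, leMap_leMap]

theorem ηInv_eq_merge (τ : ℕ) (A : C) :
    P.ηInv ((P.obj τ).obj A) = P.merge (Nat.zero_add τ).ge A := by
  rw [← Category.id_comp (P.merge _ A), ← ηInv_η, Category.assoc, η_merge, leMap_refl,
    Category.comp_id]

theorem map_ηInv_eq_merge (τ : ℕ) (A : C) :
    (P.obj τ).map (P.ηInv A) = P.merge (Nat.add_zero τ).ge A := by
  rw [← Category.id_comp (P.merge _ A), ← (P.obj τ).map_id, ← ηInv_η, Functor.map_comp,
    Category.assoc, map_η_merge, leMap_refl, Category.comp_id]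

/-- Forgetting the outer modality is an instance of merging. -/
theorem toNow_eq_merge (τ₁ τ₂ : ℕ) (A : C) :
    P.toNow τ₁ ((P.obj τ₂).obj A) = P.merge (Nat.le_add_left τ₂ τ₁) A := by
  rw [toNow, ηInv_eq_merge, leMap_merge]

/-- Forgetting the inner modality is an instance of merging. -/
theorem map_toNow_eq_merge (τ₁ τ₂ : ℕ) (A : C) :
    (P.obj τ₁).map (P.toNow τ₂ A) = P.merge (Nat.le_add_right τ₁ τ₂) A := by
  rw [toNow, Functor.map_comp, map_ηInv_eq_merge, map_leMap_merge]

theorem merge_toNow {τ₁ τ₂ τ : ℕ} (h : τ ≤ τ₁ + τ₂) (A : C) :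
    P.merge h A ≫ P.toNow τ A = P.toNow τ₁ _ ≫ P.toNow τ₂ A := by
  rw [toNow_eq_merge, toNow, toNow]
  simp only [← Category.assoc, merge_leMap]

theorem slice_toNow {τ₁ τ₂ τ : ℕ} (h : τ₁ + τ₂ ≤ τ) (A : C) :
    P.slice h A ≫ P.toNow τ₁ _ = P.leMap ((Nat.le_add_left τ₂ τ₁).trans h) A := by
  rw [toNow_eq_merge, slice_merge]

theorem slice_toNow_toNow {τ₁ τ₂ τ : ℕ} (h : τ₁ + τ₂ ≤ τ) (A : C) :
    P.slice h A ≫ P.toNow τ₁ _ ≫ P.toNow τ₂ A = P.toNow τ A := by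
  rw [reassoc_of% P.slice_toNow, leMap_toNow]

end PastModality

/-! ### Interpretation of variables -/

namespace Model

variable {S : Signature.{w}} {C : Type u} [Category.{v} C] [CartesianMonoidalCategory C]
  [MonoidalClosed C] [HasProductsOfShape S.Op C] [HasProductsOfShape ℕ C] (M : Model C S)

@[simp]
theorem var_here {Γ : Ctx S.Base} {X : Ty S.Base} (A : C) :
    M.var (Var.here (Γ := Γ) (X := X)) A = snd _ _ := by
  change 𝟙 _ ≫ M.P.η _ ≫ M.P.toNow 0 _ ≫ snd _ _ = _
  rw [Category.id_comp, reassoc_of% M.P.η_toNow]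

@[simp]
theorem var_skipVar {Γ : Ctx S.Base} {X Y : Ty S.Base} (x : Var Γ X) (A : C) :
    M.var (Var.skipVar (Y := Y) x) A = fst _ _ ≫ M.var x A := by
  change (M.iota x A ▷ M.ty Y) ≫ (fst _ _ ≫ M.collapse x.right _) ≫ M.P.toNow _ _ ≫ snd _ _ =
    fst _ _ ≫ M.iota x A ≫ _
  simp

@[simp]
theorem var_skipMod {Γ : Ctx S.Base} {X : Ty S.Base} {τ : ℕ} (x : Var Γ X) (A : C) :
    M.var (Var.skipMod (τ := τ) x) A = M.P.toNow τ _ ≫ M.var x A := by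
  change (M.P.obj τ).map (M.iota x A) ≫
    ((M.P.obj τ).map (M.collapse x.right _) ≫ M.P.merge _ _) ≫ M.P.toNow _ _ ≫ snd _ _ =
    _ ≫ M.iota x A ≫ _
  rw [Category.assoc, reassoc_of% M.P.merge_toNow, reassoc_of% M.P.toNow_natural,
    reassoc_of% M.P.toNow_natural]

/-- The interpretation of variables is natural in the initial object `A`. -/
theorem ctx_map_var {Γ : Ctx S.Base} {X : Ty S.Base} (x : Var Γ X) {A A' : C} (f : A ⟶ A') :
    (M.ctx Γ).map f ≫ M.var x A' = M.var x A := by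
  induction x with
  | here => simp
  | skipVar x ih => simp [ih]
  | skipMod x ih => simp [reassoc_of% M.P.toNow_natural, ih]

/-- The interpretation of renamings is natural in the initial object `A`. -/
theorem ctx_map_ren {Γ Γ' : Ctx S.Base} (ρ : Ren Γ Γ') {A A' : C} (f : A ⟶ A') :
    (M.ctx Γ').map f ≫ M.ren ρ A' = M.ren ρ A ≫ (M.ctx Γ).map f := by
  induction ρ with
  | id => simp [ren]
  | comp ρ' ρ ih' ih => simp [ren, ih, reassoc_of% ih']
  | wk => simp [ren]
  | var x =>
    apply CartesianMonoidalCategory.hom_ext <;> simp [ren, ctx_map_var]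
  | eta => exact M.P.η_natural _
  | etaInv => exact M.P.ηInv_natural _
  | mu τ τ' => exact M.P.merge_natural _ _
  | muInv τ τ' => exact M.P.slice_natural _ _
  | mon h => exact M.P.leMap_natural _ _
  | congVar ρ ih =>
    apply CartesianMonoidalCategory.hom_ext <;> simp [ren, ih]
  | congMod ρ ih => simp [ren, ← Functor.map_comp, ih]

/-- Renaming a variable corresponds to precomposing with the renaming. -/
theorem ren_var {Γ Γ' : Ctx S.Base} (ρ : Ren Γ Γ') {X : Ty S.Base} (x : Var Γ X) (A : C) :
    M.ren ρ A ≫ M.var x A = M.var (ρ.onVar x) A := by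
  induction ρ with
  | id => simp [ren, Ren.onVar]
  | comp ρ' ρ ih' ih => simp [ren, Ren.onVar, ih, ih']
  | wk => simp [ren, Ren.onVar]
  | var y => cases x <;> simp [ren, Ren.onVar]
  | eta => cases x; simp [ren, Ren.onVar, reassoc_of% M.P.η_toNow]
  | etaInv => simp [ren, Ren.onVar, PastModality.toNow]
  | mu τ τ' =>
    cases x with | skipMod x
    have := congrArg (· ≫ M.var x A) (M.P.merge_toNow (Nat.add_comm τ τ').le _)
    simp only [ren, Ren.onVar, var_skipMod, Category.assoc, PastModality.merge] at this ⊢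
    exact this
  | muInv τ τ' =>
    rcases x with _ | _ | (_ | _ | x)
    have := congrArg (· ≫ M.var x A) (M.P.slice_toNow_toNow (Nat.add_comm τ' τ).le _)
    simp only [ren, Ren.onVar, var_skipMod, Category.assoc, PastModality.slice] at this ⊢
    exact this
  | mon h => cases x; simp [ren, Ren.onVar, reassoc_of% M.P.leMap_toNow]
  | congVar ρ ih => cases x <;> simp [ren, Ren.onVar, ih]
  | congMod ρ ih => cases x; simp [ren, Ren.onVar, reassoc_of% M.P.toNow_natural, ih]

/-! ### Travelling back in time -/

@[simp]
theorem ctxCast_rfl {Γ : Ctx S.Base} (h : Γ = Γ) (A : C) : M.ctxCast h A = 𝟙 _ := rfl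

@[simp]
theorem ctxCast_trans {Γ₁ Γ₂ Γ₃ : Ctx S.Base} (h : Γ₁ = Γ₂) (h' : Γ₂ = Γ₃) (A : C) :
    M.ctxCast h A ≫ M.ctxCast h' A = M.ctxCast (h.trans h') A := by
  subst h h'
  simp

@[simp]
theorem ctxCast_trans_assoc {Γ₁ Γ₂ Γ₃ : Ctx S.Base} (h : Γ₁ = Γ₂) (h' : Γ₂ = Γ₃) (A : C) {Z : C}
    (f : (M.ctx Γ₃).obj A ⟶ Z) :
    M.ctxCast h A ≫ M.ctxCast h' A ≫ f = M.ctxCast (h.trans h') A ≫ f := by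
  rw [← Category.assoc, ctxCast_trans]

/-- Identifications of grades in a context denote maps of the form `⟨τ ≤ τ'⟩`. -/
theorem leMap_ctxCast {Γ Δ : Ctx S.Base} {τ τ' : ℕ} (h : τ = τ') (e : Γ.mod τ = Δ)
    (A : C) :
    M.P.leMap h.le ((M.ctx Γ).obj A) ≫ M.ctxCast e A =
      M.ctxCast ((congrArg Γ.mod h).symm.trans e) A := by
  subst h
  simp

theorem ren_cast {Γ₁ Γ₂ Γ₁' Γ₂' : Ctx S.Base} (h : Γ₁ = Γ₂) (h' : Γ₁' = Γ₂') (ρ : Ren Γ₁ Γ₁')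
    (A : C) :
    M.ren (Ren.cast h h' ρ) A = M.ctxCast h'.symm A ≫ M.ren ρ A ≫ M.ctxCast h A := by
  subst h h'
  simp [Ren.cast]

theorem etaPRA_zero (Γ : Ctx S.Base) (h : 0 ≤ Γ.time) (A : C) :
    M.etaPRA Γ 0 h A = M.P.η _ ≫ (M.P.obj 0).map (M.ctxCast Γ.minus_zero.symm A) := by
  cases Γ <;> rfl

theorem etaPRA_var (Γ : Ctx S.Base) (X : Ty S.Base) (τ : ℕ) (h : τ + 1 ≤ Γ.time) (A : C) :
    M.etaPRA (Γ.var X) (τ + 1) h A = fst _ _ ≫ M.etaPRA Γ (τ + 1) h A := rfl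

/-- The defining equation of `etaPRA` when the last modality suffices; it also holds for `σ = 0`,
by the left unit law of `⟨-⟩`. -/
theorem etaPRA_mod_of_le (Γ : Ctx S.Base) {τ σ : ℕ} (hσ : σ ≤ τ) (h : σ ≤ (Γ.mod τ).time) (A : C) :
    M.etaPRA (Γ.mod τ) σ h A =
      M.P.slice (Nat.add_sub_cancel' hσ).le ((M.ctx Γ).obj A) ≫
        (M.P.obj σ).map (M.ctxCast (Γ.minus_mod_of_le hσ).symm A) := by
  cases σ with
  | zero =>
    rw [etaPRA_zero]
    congr 1
    apply M.P.hom_ext_merge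
    rw [M.P.slice_merge]
    exact M.P.η_merge _ _
  | succ σ =>
    rw [etaPRA, dif_pos hσ, PastModality.slice, Category.assoc]

/-- The defining equation of `etaPRA` when the last modality does not suffice. -/
theorem etaPRA_mod_of_ge (Γ : Ctx S.Base) {τ σ : ℕ} (hσ : τ < σ) (h : σ ≤ (Γ.mod τ).time) (A : C) :
    M.etaPRA (Γ.mod τ) σ h A =
      (M.P.obj τ).map (M.etaPRA Γ (σ - τ) (Nat.sub_le_iff_le_add.mpr h) A) ≫
        M.P.merge (Nat.add_sub_cancel' hσ.le).ge _ ≫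
          (M.P.obj σ).map (M.ctxCast (Γ.minus_mod_of_ge hσ).symm A) := by
  cases σ with
  | zero => omega
  | succ σ =>
    rw [etaPRA, dif_neg (Nat.not_le.mpr hσ), PastModality.merge, Category.assoc]

theorem etaPRA_congr (Γ : Ctx S.Base) {σ σ' : ℕ} (e : σ = σ') (h : σ ≤ Γ.time) (A : C) :
    M.etaPRA Γ σ h A =
      M.etaPRA Γ σ' (e ▸ h) A ≫ M.P.leMap e.le _ ≫ (M.P.obj σ).map (M.ctxCast (by rw [e]) A) := by
  subst e
  simp

theorem ren_minusWk_zero (Γ : Ctx S.Base) (A : C) :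
    M.ren (Ren.minusWk Γ 0) A = M.ctxCast Γ.minus_zero.symm A := by
  have : Ren.minusWk Γ 0 = Ren.cast Γ.minus_zero.symm rfl .id := by
    cases Γ <;> simp [Ren.minusWk]
  rw [this, ren_cast]
  simp [ren]

theorem ren_wkMod (Γ : Ctx S.Base) (τ : ℕ) (A : C) :
    M.ren (Ren.wkMod (Γ := Γ) τ) A = M.P.toNow τ _ := rfl

/-- Forgetting all the time collected by `etaPRA` is the interpretation of the renaming
`Γ - σ ⇝ Γ`. -/
theorem etaPRA_toNow (Γ : Ctx S.Base) (σ : ℕ) (h : σ ≤ Γ.time) (A : C) :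
    M.etaPRA Γ σ h A ≫ M.P.toNow σ _ = M.ren (Ren.minusWk Γ σ) A := by
  induction Γ generalizing σ with
  | nil =>
    obtain rfl : σ = 0 := Nat.le_zero.mp h
    rw [etaPRA_zero, ren_minusWk_zero, Category.assoc, M.P.toNow_natural, reassoc_of% M.P.η_toNow]
  | var Γ X ih =>
    cases σ with
    | zero =>
      rw [etaPRA_zero, ren_minusWk_zero, Category.assoc, M.P.toNow_natural,
        reassoc_of% M.P.η_toNow]
    | succ σ =>
      rw [etaPRA_var, Category.assoc, ih, Ren.minusWk]
      rfl
  | mod Γ τ ih =>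
    cases σ with
    | zero =>
      rw [etaPRA_zero, ren_minusWk_zero, Category.assoc, M.P.toNow_natural,
        reassoc_of% M.P.η_toNow]
    | succ σ =>
      rw [Ren.minusWk]
      split_ifs with hσ
      · rw [etaPRA_mod_of_le _ _ hσ, Category.assoc, M.P.toNow_natural, ren_cast]
        rw [reassoc_of% M.P.slice_toNow]
        simp [ren]
      · rw [etaPRA_mod_of_ge _ _ (Nat.lt_of_not_le hσ), ren_cast, Category.assoc, Category.assoc,
          M.P.toNow_natural, reassoc_of% M.P.merge_toNow, reassoc_of% M.P.toNow_natural,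
          reassoc_of% ih]
        simp [ren, ren_wkMod]

/-- Collecting only `σ₁` and discarding the rest of the context agrees with collecting `σ₂ ≥ σ₁` and
forgetting the excess `σ₂ - σ₁`. -/
theorem etaPRA_minusMono (Γ : Ctx S.Base) (σ₁ σ₂ : ℕ) (hσ : σ₁ ≤ σ₂) (h : σ₂ ≤ Γ.time) (A : C) :
    M.etaPRA Γ σ₁ (hσ.trans h) A ≫ (M.P.obj σ₁).map (M.ren (Ren.minusMono Γ σ₁ σ₂ hσ) A) =
      M.etaPRA Γ σ₂ h A ≫ M.P.leMap hσ _ := by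
  -- `minusMono` with `σ₁ = 0` is `minusWk`, in every context.
  have zero_case : ∀ (Γ : Ctx S.Base) (σ₂ : ℕ) (h : σ₂ ≤ Γ.time),
      M.etaPRA Γ 0 (Nat.zero_le _) A ≫
          (M.P.obj 0).map (M.ren (Ren.minusMono Γ 0 σ₂ (Nat.zero_le _)) A) =
        M.etaPRA Γ σ₂ h A ≫ M.P.leMap (Nat.zero_le _) _ := by
    intro Γ σ₂ h
    have e : Ren.minusMono Γ 0 σ₂ (Nat.zero_le _) =
        Ren.cast rfl Γ.minus_zero.symm (Ren.minusWk Γ σ₂) := by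
      cases Γ <;> cases σ₂ <;> simp [Ren.minusMono]
    rw [e, ren_cast, etaPRA_zero, Category.assoc, ← Functor.map_comp, ctxCast_trans_assoc,
      ctxCast_rfl, ctxCast_rfl, Category.id_comp, Category.comp_id, ← M.P.η_natural,
      ← etaPRA_toNow M Γ σ₂ h, PastModality.toNow]
    simp
  induction Γ generalizing σ₁ σ₂ with
  | nil =>
    obtain rfl : σ₂ = 0 := Nat.le_zero.mp h
    obtain rfl : σ₁ = 0 := Nat.le_zero.mp hσ
    exact zero_case _ _ _
  | var Γ X ih =>
    rcases σ₁ with _ | σ₁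
    · exact zero_case _ _ _
    rcases σ₂ with _ | σ₂
    · omega
    rw [etaPRA_var, etaPRA_var, Category.assoc, Category.assoc, ← ih, Ren.minusMono]
  | mod Γ τ ih =>
    rcases σ₁ with _ | σ₁
    · exact zero_case _ _ _
    rcases σ₂ with _ | σ₂
    · omega
    rw [Ren.minusMono]
    split_ifs with h₂ h₁
    · rw [etaPRA_mod_of_le _ _ h₂, etaPRA_mod_of_le _ _ (hσ.trans h₂), ren_cast, Category.assoc,
        ← Functor.map_comp, ctxCast_trans_assoc, ctxCast_rfl, Category.id_comp, Category.assoc,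
        M.P.leMap_natural, Functor.map_comp, ← Category.assoc, ← Category.assoc]
      congr 1
      apply M.P.hom_ext_merge
      simp only [ren, Category.assoc]
      erw [M.P.map_leMap_merge, M.P.leMap_merge]
      rw [M.P.slice_merge, M.P.slice_merge]
    · rw [etaPRA_mod_of_ge _ _ (Nat.lt_of_not_le h₂), etaPRA_mod_of_le _ _ h₁, ren_cast,
        Category.assoc, ← Functor.map_comp, ctxCast_trans_assoc, ctxCast_rfl, Category.id_comp,
        Category.assoc, Category.assoc, M.P.leMap_natural, Functor.map_comp, ← Category.assoc,
        ← Category.assoc, ← Category.assoc]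
      congr 1
      simp only [ren, ren_wkMod, Functor.map_comp]
      -- Both sides collect `σ₂ - τ` from `Γ`; one forgets it inside, the other one outside.
      rw [← etaPRA_toNow M Γ _ (Nat.sub_le_iff_le_add.mpr h), M.P.map_toNow_eq_merge,
        reassoc_of% M.P.slice_merge, Functor.map_comp, M.P.map_toNow_eq_merge,
        ← reassoc_of% M.P.leMap_natural, M.P.leMap_merge, Category.assoc, M.P.merge_leMap]
    · have hh₁ := Nat.lt_of_not_le h₁
      have hh₂ := Nat.lt_of_not_le h₂
      rw [etaPRA_mod_of_ge _ _ hh₂, etaPRA_mod_of_ge _ _ hh₁, ren_cast,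
        Category.assoc, Category.assoc, ← Functor.map_comp, ctxCast_trans_assoc, ctxCast_rfl,
        Category.id_comp, Functor.map_comp, ← reassoc_of% M.P.merge_natural,
        ← reassoc_of% (M.P.obj τ).map_comp, ih _ _ _ (Nat.sub_le_iff_le_add.mpr h),
        (M.P.obj τ).map_comp]
      simp only [Category.assoc]
      rw [reassoc_of% M.P.map_leMap_merge, M.P.leMap_natural, reassoc_of% M.P.merge_leMap]

/-- `etaPRA` is natural in renamings that split a modality. The cases are those of `minusMu`, with
its last case divided according to whether `σ` reaches beyond both modalities. -/
theorem ren_mu_etaPRA (Γ : Ctx S.Base) (τ τ' σ : ℕ) (h : σ ≤ (Γ.mod (τ + τ')).time)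
    (h' : σ ≤ ((Γ.mod τ).mod τ').time) (A : C) :
    M.ren (Ren.mu (Γ := Γ) τ τ') A ≫ M.etaPRA (Γ.mod (τ + τ')) σ h A =
      M.etaPRA ((Γ.mod τ).mod τ') σ h' A ≫
        (M.P.obj σ).map (M.ren (Ren.minusMu Γ τ τ' σ) A) := by
  change M.P.merge (Nat.add_comm τ τ').le _ ≫ _ = _
  rw [Ren.minusMu]
  split_ifs with h₁
  · have key : M.P.merge (Nat.add_comm τ τ').le ((M.ctx Γ).obj A) ≫
          M.P.slice (by omega : σ + (τ + τ' - σ) ≤ τ + τ') _ =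
        M.P.slice (by omega : σ + (τ' - σ) ≤ τ') _ ≫
          (M.P.obj σ).map (M.P.merge (by omega : τ + τ' - σ ≤ (τ' - σ) + τ) _) := by
      apply M.P.hom_ext_merge
      rw [Category.assoc, Category.assoc, M.P.slice_merge, M.P.merge_leMap,
        ← M.P.merge_assoc (by omega : τ' ≤ σ + (τ' - σ)) _ (by omega), reassoc_of% M.P.slice_merge,
        M.P.leMap_merge]
    rw [ren_cast, etaPRA_mod_of_le _ _ h₁, etaPRA_mod_of_le _ _ (by omega : σ ≤ τ + τ'),
      Category.assoc, ← Functor.map_comp, ctxCast_trans_assoc, ctxCast_rfl, Category.id_comp,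
      reassoc_of% key, ← Functor.map_comp,
      ← M.leMap_ctxCast (by omega : τ + (τ' - σ) = τ + τ' - σ), ← Category.assoc (M.P.merge _ _),
      M.P.merge_leMap]
    rfl
  · have h₁' := Nat.lt_of_not_le h₁
    rw [ren_cast, etaPRA_mod_of_ge _ _ h₁']
    by_cases h₂ : σ ≤ τ + τ'
    · have key : M.P.merge (Nat.add_comm τ τ').le ((M.ctx Γ).obj A) ≫
            M.P.slice (by omega : σ + (τ + τ' - σ) ≤ τ + τ') _ =
          (M.P.obj τ').map (M.P.slice (by omega : (σ - τ') + (τ - (σ - τ')) ≤ τ) _) ≫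
            M.P.merge (by omega : σ ≤ τ' + (σ - τ')) _ ≫
              (M.P.obj σ).map (M.P.leMap (by omega : τ + τ' - σ ≤ τ - (σ - τ')) _) := by
        apply M.P.hom_ext_merge
        simp only [Category.assoc]
        rw [M.P.map_leMap_merge, M.P.slice_merge, M.P.merge_leMap,
          M.P.merge_assoc _ (by omega : τ ≤ σ - τ' + (τ - (σ - τ'))) _ (by omega),
          ← Functor.map_comp_assoc, M.P.slice_merge, M.P.map_leMap_merge]
      rw [etaPRA_mod_of_le _ _ h₂, etaPRA_mod_of_le _ _ (by omega : σ - τ' ≤ τ),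
        reassoc_of% key]
      simp only [Category.assoc, Functor.map_comp]
      rw [reassoc_of% M.P.merge_natural]
      simp only [← Functor.map_comp]
      rw [M.leMap_ctxCast (by omega)]
      simp [ren]
    · rw [etaPRA_mod_of_ge _ _ (Nat.lt_of_not_le h₂),
        etaPRA_mod_of_ge _ _ (by omega : τ < σ - τ'),
        M.etaPRA_congr Γ (by omega : σ - (τ + τ') = σ - τ' - τ)]
      simp only [Functor.map_comp, Category.assoc]
      rw [reassoc_of% M.P.merge_natural, reassoc_of% M.P.merge_natural,
        reassoc_of% M.P.map_leMap_merge, ← reassoc_of% M.P.merge_natural,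
        reassoc_of% M.P.merge_assoc _ (by omega : σ - τ' ≤ τ + (σ - τ' - τ)) _ (by omega)]
      simp only [← Functor.map_comp]
      simp [ren]

theorem ren_mu_muInv (Γ : Ctx S.Base) (τ τ' : ℕ) (A : C) :
    M.ren (Ren.mu (Γ := Γ) τ τ') A ≫ M.ren (Ren.muInv τ τ') A = 𝟙 _ := by
  simp only [ren, Category.assoc]
  rw [M.P.leMap_leMap_assoc, M.P.leMap_refl, Category.id_comp, M.P.μ_μInv]
  rfl

theorem ren_muInv_mu (Γ : Ctx S.Base) (τ τ' : ℕ) (A : C) :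
    M.ren (Ren.muInv (Γ := Γ) τ τ') A ≫ M.ren (Ren.mu τ τ') A = 𝟙 _ := by
  simp only [ren, Category.assoc]
  rw [reassoc_of% M.P.μInv_μ, M.P.leMap_leMap, M.P.leMap_refl]
  rfl

theorem ren_minusMu_minusMuInv (Γ : Ctx S.Base) (τ τ' σ : ℕ) (A : C) :
    M.ren (Ren.minusMu Γ τ τ' σ) A ≫ M.ren (Ren.minusMuInv Γ τ τ' σ) A = 𝟙 _ := by
  rw [Ren.minusMu, Ren.minusMuInv]
  split_ifs with h₁
  · rw [ren_cast, ren_cast]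
    simp [reassoc_of% M.ren_mu_muInv]
  · rw [ren_cast, ren_cast]
    simp [ren]

/-- `etaPRA` is natural in renamings that join two modalities, since these and their images under
`- ∸ σ` are inverse to the renamings that split a modality. -/
theorem ren_muInv_etaPRA (Γ : Ctx S.Base) (τ τ' σ : ℕ) (h : σ ≤ ((Γ.mod τ).mod τ').time)
    (h' : σ ≤ (Γ.mod (τ + τ')).time) (A : C) :
    M.ren (Ren.muInv (Γ := Γ) τ τ') A ≫ M.etaPRA ((Γ.mod τ).mod τ') σ h A =
      M.etaPRA (Γ.mod (τ + τ')) σ h' A ≫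
        (M.P.obj σ).map (M.ren (Ren.minusMuInv Γ τ τ' σ) A) := by
  rw [← Category.id_comp (M.etaPRA (Γ.mod (τ + τ')) σ h' A), ← ren_muInv_mu, Category.assoc,
    Category.assoc, reassoc_of% M.ren_mu_etaPRA Γ τ τ' σ h' h, ← Functor.map_comp,
    ren_minusMu_minusMuInv, CategoryTheory.Functor.map_id, Category.comp_id]

/-- `etaPRA` is natural in renamings that enlarge a modality. -/
theorem ren_mon_etaPRA (Γ : Ctx S.Base) {τ τ' : ℕ} (hτ : τ ≤ τ') (σ : ℕ)
    (h : σ ≤ (Γ.mod τ).time) (h' : σ ≤ (Γ.mod τ').time) (A : C) :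
    M.ren (Ren.mon (Γ := Γ) hτ) A ≫ M.etaPRA (Γ.mod τ) σ h A =
      M.etaPRA (Γ.mod τ') σ h' A ≫ (M.P.obj σ).map (M.ren (Ren.minusMon Γ hτ σ) A) := by
  change M.P.leMap hτ _ ≫ _ = _
  rw [Ren.minusMon]
  split_ifs with h₁ h₂
  · rw [ren_cast, etaPRA_mod_of_le _ _ h₁, etaPRA_mod_of_le _ _ (h₁.trans hτ), Category.assoc,
      ← Functor.map_comp, ctxCast_trans_assoc, ctxCast_rfl, Category.id_comp, Functor.map_comp]
    simp only [← Category.assoc]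
    congr 1
    apply M.P.hom_ext_merge
    simp only [ren, Category.assoc]
    erw [M.P.map_leMap_merge]
    rw [M.P.slice_merge, M.P.slice_merge, M.P.leMap_leMap]
  · have hh₁ := Nat.lt_of_not_le h₁
    rw [ren_cast, etaPRA_mod_of_ge _ _ hh₁, etaPRA_mod_of_le _ _ h₂, Category.assoc,
      ← Functor.map_comp, ctxCast_trans_assoc, ctxCast_rfl, Category.id_comp]
    simp only [ren, ren_wkMod, Functor.map_comp, Category.assoc]
    rw [← etaPRA_toNow M Γ _ (Nat.sub_le_iff_le_add.mpr h), M.P.map_toNow_eq_merge,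
      reassoc_of% M.P.slice_merge, Functor.map_comp, M.P.map_toNow_eq_merge, Category.assoc,
      ← reassoc_of% M.P.leMap_natural, ← reassoc_of% M.P.leMap_natural,
      reassoc_of% M.P.leMap_merge, reassoc_of% M.P.leMap_merge]
  · have hh₁ := Nat.lt_of_not_le h₁
    have hh₂ := Nat.lt_of_not_le h₂
    rw [ren_cast, etaPRA_mod_of_ge _ _ hh₁, etaPRA_mod_of_ge _ _ hh₂, Category.assoc,
      Category.assoc, ← Functor.map_comp, ctxCast_trans_assoc, ctxCast_rfl, Category.id_comp,
      Functor.map_comp, ← reassoc_of% M.P.merge_natural, ← reassoc_of% (M.P.obj τ').map_comp,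
      etaPRA_minusMono M _ _ _ _ (Nat.sub_le_iff_le_add.mpr h), (M.P.obj τ').map_comp,
      ← reassoc_of% M.P.leMap_natural, reassoc_of% M.P.leMap_merge, Category.assoc,
      reassoc_of% M.P.map_leMap_merge]

/-- `etaPRA` is natural in all renamings: the square that the denotation of `unbox` needs. -/
theorem ren_etaPRA {Γ Γ' : Ctx S.Base} (ρ : Ren Γ Γ') (σ : ℕ) (h : σ ≤ Γ.time)
    (h' : σ ≤ Γ'.time) (A : C) :
    M.ren ρ A ≫ M.etaPRA Γ σ h A =
      M.etaPRA Γ' σ h' A ≫ (M.P.obj σ).map (M.ren (ρ.minus σ) A) := by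
  induction ρ generalizing σ with
  | id => simp [ren, Ren.minus]
  | comp ρ' ρ ih' ih =>
    simp [ren, Ren.minus, ih σ h (h.trans ρ.time_le), reassoc_of% ih' σ (h.trans ρ.time_le) h']
  | @wk Γ X =>
    cases σ with
    | zero =>
      rw [etaPRA_zero, etaPRA_zero, Ren.minus, ren_cast, reassoc_of% M.P.η_natural]
      simp [← Functor.map_comp]
    | succ σ => simp [ren, Ren.minus, etaPRA_var]
  | @var Γ X x =>
    cases σ with
    | zero =>
      rw [etaPRA_zero, etaPRA_zero, Ren.minus, ren_cast, reassoc_of% M.P.η_natural]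
      simp [← Functor.map_comp]
    | succ σ => simp [ren, Ren.minus, etaPRA_var]
  | @eta Γ =>
    cases σ with
    | zero =>
      rw [etaPRA_zero, etaPRA_zero, Ren.minus, ren_cast, reassoc_of% M.P.η_natural]
      simp [← Functor.map_comp]
    | succ σ =>
      rw [Ren.minus, ren_cast, etaPRA_mod_of_ge _ _ (Nat.succ_pos σ)]
      simp only [ren]
      rw [← reassoc_of% M.P.η_natural, reassoc_of% M.P.η_merge]
      simp
  | @etaInv Γ =>
    cases σ with
    | zero =>
      rw [etaPRA_zero, etaPRA_zero, Ren.minus, ren_cast, reassoc_of% M.P.η_natural]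
      simp [← Functor.map_comp]
    | succ σ =>
      rw [Ren.minus, ren_cast, etaPRA_mod_of_ge _ _ (Nat.succ_pos σ)]
      simp only [ren]
      -- `σ + 1 - 0` is `σ + 1` by definition, which removes the identification of contexts.
      change M.P.ηInv _ ≫ _ =
        ((M.P.obj 0).map (M.etaPRA Γ (σ + 1) h A) ≫ M.P.merge (Nat.zero_add (σ + 1)).ge _ ≫ _) ≫ _
      rw [← M.P.ηInv_eq_merge, reassoc_of% M.P.ηInv_natural]
      simp [← Functor.map_comp]
  | mu τ τ' => exact ren_mu_etaPRA ..
  | muInv τ τ' => exact ren_muInv_etaPRA ..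
  | mon hτ => exact ren_mon_etaPRA ..
  | @congVar Γ Γ' X ρ ih =>
    cases σ with
    | zero =>
      rw [etaPRA_zero, etaPRA_zero, Ren.minus, reassoc_of% M.P.η_natural]
      simp
    | succ σ =>
      simp only [Ren.minus, etaPRA_var, ren]
      rw [Category.assoc, ← ih _ h]
      simp
  | @congMod Γ Γ' τ ρ ih =>
    rw [Ren.minus]
    split_ifs with hσ
    · rw [ren_cast, etaPRA_mod_of_le _ _ hσ, etaPRA_mod_of_le _ _ hσ, ren,
        reassoc_of% M.P.slice_natural]
      simp only [Category.assoc, ← Functor.map_comp]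
      simp [ren]
    · have hh := Nat.lt_of_not_le hσ
      rw [ren_cast, etaPRA_mod_of_ge _ _ hh, etaPRA_mod_of_ge _ _ hh, ren,
        ← Functor.map_comp_assoc, ih _ _ (Nat.sub_le_iff_le_add.mpr h'), Functor.map_comp]
      simp only [Category.assoc]
      rw [reassoc_of% M.P.merge_natural]
      simp [← Functor.map_comp]

end Model

/-! ### Precomposition of the semantic operations -/

section Precomposition

variable {C : Type u} [Category.{v} C] [CartesianMonoidalCategory C] {Z Z' : C} (g : Z' ⟶ Z)

theorem comp_finLift (n : ℕ) (X : Fin n → C) (f : (i : Fin n) → (Z ⟶ X i)) :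
    g ≫ finLift n X f = finLift n X (fun i => g ≫ f i) := by
  induction n with
  | zero => exact toUnit_unique _ _
  | succ n ih => exact (comp_lift _ _ _).trans (congrArg (lift _) (ih _ _))

theorem comp_cur [MonoidalClosed C] {X Y : C} (f : Z ⊗ X ⟶ Y) :
    g ≫ cur f = cur ((g ▷ X) ≫ f) := by
  rw [cur, cur, ← MonoidalClosed.curry_natural_left]
  congr 1
  rw [← Category.assoc, ← Category.assoc]
  congr 1
  apply CartesianMonoidalCategory.hom_ext <;> simp

theorem comp_cur_assoc_inv [MonoidalClosed C] {X Y W : C} (f : (Z ⊗ X) ⊗ Y ⟶ W) :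
    g ≫ cur ((α_ Z X Y).inv ≫ f) = cur ((α_ Z' X Y).inv ≫ ((g ▷ X) ▷ Y) ≫ f) := by
  rw [comp_cur, associator_inv_naturality_left_assoc]

theorem comp_split {X Y W : C} (f : Z ⟶ X ⊗ Y) (k : (Z ⊗ X) ⊗ Y ⟶ W) :
    g ≫ lift (𝟙 Z) f ≫ (α_ Z X Y).inv ≫ k =
      lift (𝟙 Z') (g ≫ f) ≫ (α_ Z' X Y).inv ≫ ((g ▷ X) ▷ Y) ≫ k := by
  have e : g ≫ lift (𝟙 Z) f = lift (𝟙 Z') (g ≫ f) ≫ (g ▷ (X ⊗ Y)) := by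
    apply CartesianMonoidalCategory.hom_ext <;> simp [-whiskerRight_tensor]
  rw [reassoc_of% e, associator_inv_naturality_left_assoc]

/-- The shape of the denotation of `unbox`: the tuple of the identity and a composite, followed by
a morphism out of the extended context. -/
theorem comp_unbox {X X' Y W : C} {e : Z ⟶ X} {f : X ⟶ Y} {e' : Z' ⟶ X'} {f' : X' ⟶ Y}
    (h : g ≫ e ≫ f = e' ≫ f') {V : C} (c : Y ⟶ V) (k : Z ⊗ V ⟶ W) :
    g ≫ lift (𝟙 Z) e ≫ (Z ◁ f) ≫ (Z ◁ c) ≫ k =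
      lift (𝟙 Z') e' ≫ (Z' ◁ f') ≫ (Z' ◁ c) ≫ (g ▷ V) ≫ k := by
  simp only [← Category.assoc]
  congr 1
  apply CartesianMonoidalCategory.hom_ext
  · simp
  · simp [reassoc_of% h]

end Precomposition

/-- Precomposition of a tuple of morphisms indexed by the operations and the grades. -/
theorem comp_clauses {ι κ : Type*} {C : Type u} [Category.{v} C] [HasProductsOfShape ι C]
    [HasProductsOfShape κ C] {Z Z' : C} (g : Z' ⟶ Z) {X : ι → κ → C}
    {f : (i : ι) → (k : κ) → (Z ⟶ X i k)} {f' : (i : ι) → (k : κ) → (Z' ⟶ X i k)}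
    (h : ∀ i k, f' i k = g ≫ f i k) :
    g ≫ Pi.lift (fun _ : ι => Pi.lift (fun _ : κ => 𝟙 Z)) ≫
        Limits.Pi.map (fun i : ι => Limits.Pi.map (fun k : κ => f i k)) =
      Pi.lift (fun _ : ι => Pi.lift (fun _ : κ => 𝟙 Z')) ≫
        Limits.Pi.map (fun i : ι => Limits.Pi.map (fun k : κ => f' i k)) := by
  apply Limits.Pi.hom_ext
  intro i
  apply Limits.Pi.hom_ext
  intro k
  simp [h]

theorem Modalities.comp_unit {C : Type u} [Category.{v} C] (K : Modalities C) (τ : ℕ)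
    {Z Z' : C} (g : Z' ⟶ Z) :
    g ≫ (K.adj τ).unit.app Z =
      (K.adj τ).unit.app Z' ≫ (K.F.obj τ).map ((K.P.obj τ).map g) :=
  (K.adj τ).unit.naturality g

theorem Modalities.comp_box {C : Type u} [Category.{v} C] (K : Modalities C) (τ : ℕ)
    {Z Z' Y : C} (g : Z' ⟶ Z) (f : (K.P.obj τ).obj Z ⟶ Y) :
    g ≫ (K.adj τ).unit.app Z ≫ (K.F.obj τ).map f =
      (K.adj τ).unit.app Z' ≫ (K.F.obj τ).map ((K.P.obj τ).map g ≫ f) := by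
  rw [reassoc_of% K.comp_unit, Functor.map_comp]

namespace GradedModel

variable {C : Type u} [Category.{v} C] [CartesianMonoidalCategory C] (G : GradedModel C)
  (τ : ℕ) {Z Z' : C} (g : Z' ⟶ Z)

/-- Precomposition of the sequencing of a computation with a continuation. -/
theorem comp_str {X Y : C} (f : Z ⟶ (G.T τ).obj X) (k : (G.P.obj τ).obj Z ⊗ X ⟶ Y) :
    g ≫ lift ((G.adj τ).unit.app Z) f ≫ G.str τ _ X ≫ (G.T τ).map k =
      lift ((G.adj τ).unit.app Z') (g ≫ f) ≫ G.str τ _ X ≫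
        (G.T τ).map (((G.P.obj τ).map g ▷ X) ≫ k) := by
  have hs := G.str_natural τ ((G.P.obj τ).map g) (𝟙 X)
  have e : g ≫ lift ((G.adj τ).unit.app Z) f =
      lift ((G.adj τ).unit.app Z') (g ≫ f) ≫
        ((G.F.obj τ).map ((G.P.obj τ).map g) ⊗ₘ (G.T τ).map (𝟙 X)) := by
    rw [comp_lift, G.comp_unit]
    erw [lift_map]
    rw [CategoryTheory.Functor.map_id, Category.comp_id]
  rw [reassoc_of% e, reassoc_of% hs, Functor.map_comp, MonoidalCategory.tensorHom_id]

theorem comp_perform [MonoidalClosed C] {A X Y W : C} (f : Z ⟶ A)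
    (k : (G.P.obj τ).obj Z ⊗ X ⟶ Y) (o : A ⊗ (G.F.obj τ).obj (expo X Y) ⟶ W) :
    g ≫ lift f ((G.adj τ).unit.app Z) ≫ (A ◁ (G.F.obj τ).map (cur k)) ≫ o =
      lift (g ≫ f) ((G.adj τ).unit.app Z') ≫
        (A ◁ (G.F.obj τ).map (cur (((G.P.obj τ).map g ▷ X) ≫ k))) ≫ o := by
  simp only [← Category.assoc]
  congr 1
  apply CartesianMonoidalCategory.hom_ext
  · simp
  · have := G.comp_box τ g (cur k)
    rw [comp_cur] at this
    simpa using this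

/-- Precomposition of the handling of a computation that is sequenced with a continuation. -/
theorem comp_handle {X Y H W : C} (f : Z ⟶ (G.T τ).obj X) (k : (G.P.obj τ).obj Z ⊗ X ⟶ Y)
    {c : Z ⟶ H} {c' : Z' ⟶ H} (hc : g ≫ c = c') (d : H ⊗ (G.T τ).obj Y ⟶ W) :
    g ≫ lift (𝟙 Z) (lift ((G.adj τ).unit.app Z) f) ≫ (Z ◁ G.str τ _ X) ≫
        (Z ◁ (G.T τ).map k) ≫ (c ▷ _) ≫ d =
      lift (𝟙 Z') (lift ((G.adj τ).unit.app Z') (g ≫ f)) ≫ (Z' ◁ G.str τ _ X) ≫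
        (Z' ◁ (G.T τ).map (((G.P.obj τ).map g ▷ X) ≫ k)) ≫ (c' ▷ _) ≫ d := by
  simp only [← Category.assoc]
  congr 1
  apply CartesianMonoidalCategory.hom_ext
  · simp [hc]
  · have := G.comp_str τ g f k
    simpa [-comp_lift] using this

end GradedModel

/-! ### Interpretation of renamed derivations -/

namespace Model

variable {S : Signature.{w}} {C : Type u} [Category.{v} C] [CartesianMonoidalCategory C]
  [MonoidalClosed C] [HasProductsOfShape S.Op C] [HasProductsOfShape ℕ C] (M : Model C S)

/-- The denotation of a renamed derivation. -/
theorem tm_rename {Γ : Ctx S.Base} {J : Judg S.Base} (t : Tm S Γ J) {Γ' : Ctx S.Base}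
    (ρ : Ren Γ Γ') : M.tm (t.rename ρ) = M.ren ρ (𝟙_ C) ≫ M.tm t := by
  induction t generalizing Γ' with
  | var x => exact (M.ren_var ρ x _).symm
  | const f V ih => simp only [Tm.rename, tm, ih, ← comp_finLift, Category.assoc]
  | unit => exact toUnit_unique _ _
  | pair V W ihV ihW =>
    rw [Tm.rename, tm, tm, ihV, ihW]
    exact (comp_lift _ _ _).symm
  | lam N ih =>
    rw [Tm.rename, tm, tm, ih]
    exact (comp_cur _ _).symm
  | box τ V ih =>
    rw [Tm.rename, tm, tm, ih]
    exact (M.comp_box τ _ _).symm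
  | ret V ih => simp only [Tm.rename, tm, ih, Category.assoc]
  | letIn N N' ih ih' =>
    rw [Tm.rename, tm, tm, ih, ih']
    have := congrArg (· ≫ (M.μT _ _).app _) (M.comp_str _ (M.ren ρ (𝟙_ C)) (M.tm N) (M.tm N'))
    simp only [Category.assoc] at this
    exact this.symm
  | app V W ihV ihW =>
    rw [Tm.rename, tm, tm, ihV, ihW, ← comp_lift, Category.assoc]
  | split V N ihV ihN =>
    rw [Tm.rename, tm, tm, ihV, ihN]
    exact (comp_split _ _ _).symm
  | perform o V N ihV ihN =>
    rw [Tm.rename, tm, tm, ihV, ihN]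
    exact (M.comp_perform _ _ _ _ _).symm
  | delay τ N ih =>
    rw [Tm.rename, tm, tm, ih]
    have := congrArg (· ≫ (M.delayT _ _).app _) (M.comp_box τ (M.ren ρ (𝟙_ C)) (M.tm N))
    simp only [Category.assoc] at this
    exact this.symm
  | handle N H N' ih ihH ih' =>
    rw [Tm.rename, tm, tm, ih, ih']
    refine (M.comp_handle _ _ _ _ (comp_clauses _ fun o τ'' => ?_) _).symm
    rw [ihH]
    exact (comp_cur_assoc_inv _ _).symm
  | unbox τ h V N ihV ihN =>
    rw [Tm.rename, tm, tm, ihV, ihN]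
    refine (comp_unbox _ ?_ _ _).symm
    rw [Functor.map_comp, reassoc_of% M.ren_etaPRA ρ τ h (h.trans ρ.time_le)]

end Model

end LambdaTau

theorem proposition3 {S : Signature.{w}} {C : Type u} [Category.{v} C]
    [CartesianMonoidalCategory C] [MonoidalClosed C]
    [HasProductsOfShape S.Op C] [HasProductsOfShape ℕ C]
    (M : Model C S) {Γ Γ' : Ctx S.Base} (ρ : Ren Γ Γ') :
    (∀ {J : Judg S.Base} (t : Tm S Γ J), M.tm (t.rename ρ) = M.ren ρ (𝟙_ C) ≫ M.tm t) ∧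
    (∀ {A A' : C} (f : A ⟶ A'),
      (M.ctx Γ').map f ≫ M.ren ρ A' = M.ren ρ A ≫ (M.ctx Γ).map f) := by
  exact ⟨fun t => M.tm_rename t ρ, fun f => M.ctx_map_ren ρ f⟩
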